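/- **Setting.** Let $K$ be a number field of degree $n$ with ring of integers $R$, and let $\theta:K\to\mathbb{R}^n$ be the canonical embedding $\theta(x)=(\sigma_1(x),\dots,\sigma_{s_1}(x),\operatorname{Re}\sigma_{s_1+1}(x),\dots,\operatorname{Re}\sigma_{s_1+s_2}(x),\operatorname{Im}\sigma_{s_1+1}(x),\dots,\operatorname{Im}\sigma_{s_1+s_2}(x))$, where $\sigma_1,\dots,\sigma_{s_1}$ are the real embeddings and $\sigma_{s_1+1},\dots,\sigma_{s_1+s_2}$ represent the conjugate pairs of complex embeddings. For $\sigma>0$ the discrete Gaussian $\chi_\sigma$ on $R$ gives $x\in R$ a probability proportional to $\exp(-|\theta(x)|^2/(2\sigma^2))$. For a prime $q$ put $R_q=R/qR$. A (non-dual) Ring-LWE sample with secret $s\in R_q$ is a pair $(a,as+e)\in R_q\times R_q$, with $a$ uniform in $R_q$ and $e$ drawn independently from $\chi_\sigma$ and reduced modulo $q$. The decision problem is to tell independent Ring-LWE samples with a common unknown secret from independent uniform samples of $R_q\times R_q$. **Theorem.** Let $q$ be a prime, $n$ an integer and $f=f_{n,q}=x^n+q-1$, and suppose that 1. $n$ is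 a power of a prime $p$, 2. $q-1$ is squarefree, 3. $p^2\nmid (1-q)^n-(1-q)$. Let $K=\mathbb{Q}(\beta)$ with $f(\beta)=0$, let $M_\beta$ be the matrix with columns $\theta(1),\theta(\beta),\dots,\theta(\beta^{n-1})$, let $\sigma>0$, let $w=\sqrt{2\pi}\,\sigma/|\det M_\beta|^{1/n}$ be the width of the error distribution relative to the lattice $\theta(R)$, and suppose that 4. $\displaystyle \tau:=\frac{q}{2\sqrt2\,w\,n\,(q-1)^{\frac12-\frac1{2n}}}>1 .$ Then $K$ has degree $n$, $R=\mathbb{Z}[\beta]$, and the non-dual Ring-LWE decision problem for $K$, $q$, $\sigma$ can be solved in time $\widetilde O(\ell q)$ with probability $1-2^{-\ell}$ from $O(\ell+\log q)$ samples. Precisely: there are a single deterministic program for a random access machine with bit cost, and absolute constants $C_1,C_2,k\in\mathbb{N}$, such that for all such $n,q,K,\beta,\sigma$ and all $\ell\ge1$ the program, given $n$, $q$ and $m=C_1(\ell+\lfloor\log_2 q\rfloor)$ pairs of elements of $R_q$, written as coefficient vectors with respect to $1,\beta,\dots,\beta^{n-1}$, * halts on every such input with output $0$ or $1$ within $C_2\,N\,(\lfloor\log_2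 N\rfloor+1)^k$ bit operations, where $N=\ell\max(n,q)$ (so $N=\ell q$ if $n\le q$, in particular whenever $w\ge 1/(2\sqrt2)$); * for every secret $s\in R_q$, outputs $1$ on $m$ independent Ring-LWE samples with secret $s$ with probability at least $1-2^{-\ell}$; * outputs $0$ on $m$ independent uniform samples with probability at least $1-2^{-\ell}$. -/

import Mathlib

open NumberField NumberField.InfinitePlace NumberField.mixedEmbedding
open scoped ENNReal

/-! ### The canonical embedding, and Gaussians on the ring of integers -/

section Embedding

variable (K : Type*) [Field K]

/-- The canonical embedding `θ : K → ℝⁿ`: the real embeddings, and the real and imaginary parts of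
one complex embedding from each conjugate pair.  The coordinates are indexed by
`{real places} ⊕ {complex places} × Fin 2`, a set with `n = [K : ℚ]` elements. -/
noncomputable def theta [NumberField K] (x : K) : EuclideanSpace ℝ (index K) :=
  WithLp.toLp 2 fun i => match i with
    | Sum.inl v => embedding_of_isReal v.2 x
    | Sum.inr (v, j) => if j = 0 then (v.1.embedding x).re else (v.1.embedding x).im

variable {K}

open scoped Classical in
/-- The square matrix `M_β` whose columns are `θ(β^j)`, `0 ≤ j < n`.  Rows and columns are indexed
by the same type; an enumeration of it puts the columns in bijection with the exponents `j`.  (The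
absolute value of the determinant does not depend on the enumeration.) -/
noncomputable def embeddingMatrix [NumberField K] (β : 𝓞 K) : Matrix (index K) (index K) ℝ :=
  Matrix.of fun i j => theta K ((β : K) ^ ((Fintype.equivFin (index K)) j : ℕ)) i

open scoped Classical in
/-- The `n`-th root of `|det M_β|`, where `n = [K : ℚ]`. -/
noncomputable def detRoot [NumberField K] (β : 𝓞 K) : ℝ :=
  |(embeddingMatrix β).det| ^ ((1 : ℝ) / (Module.finrank ℚ K : ℝ))

/-- The width `w` of a Gaussian of parameter `σ` in `θ(𝓞 K) ⊗ ℝ`, measured relative to the density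
of the lattice: `w = √(2π) σ'` where `σ = σ' |det M_β|^(1/n)`. -/
noncomputable def gaussianWidth [NumberField K] (β : 𝓞 K) (σ : ℝ) : ℝ :=
  Real.sqrt (2 * Real.pi) * (σ / detRoot β)

variable (K)

open scoped Classical in
/-- The unnormalised Gaussian weight `exp (-|θ(x)|² / (2σ²))`. -/
noncomputable def gaussianWeight [NumberField K] (σ : ℝ) (x : 𝓞 K) : ℝ≥0∞ :=
  ENNReal.ofReal (Real.exp (-‖theta K (x : K)‖ ^ 2 / (2 * σ ^ 2)))

open scoped Classical in
theorem place_le_norm_theta [NumberField K] (v : InfinitePlace K) (x : K) :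
    v x ≤ ‖theta K x‖ := by
  refine le_of_sq_le_sq ?_ (norm_nonneg _)
  rw [EuclideanSpace.norm_sq_eq, Fintype.sum_sum_type, Fintype.sum_prod_type]
  rcases isReal_or_isComplex v with hv | hv
  · have h1 := Finset.single_le_sum
      (f := fun i : {w : InfinitePlace K // IsReal w} => ‖theta K x (Sum.inl i)‖ ^ 2)
      (fun i _ => by positivity) (Finset.mem_univ ⟨v, hv⟩)
    have h2 : v x = ‖theta K x (Sum.inl ⟨v, hv⟩)‖ := by
      simp only [theta]
      exact (norm_embedding_of_isReal hv x).symm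
    rw [h2]
    refine h1.trans (le_add_of_nonneg_right ?_)
    exact Finset.sum_nonneg fun i _ => Finset.sum_nonneg fun j _ => by positivity
  · have h1 := Finset.single_le_sum
      (f := fun i : {w : InfinitePlace K // IsComplex w} =>
        ∑ j : Fin 2, ‖theta K x (Sum.inr (i, j))‖ ^ 2)
      (fun i _ => Finset.sum_nonneg fun j _ => by positivity) (Finset.mem_univ ⟨v, hv⟩)
    have h2 : v x ^ 2 = ∑ j : Fin 2, ‖theta K x (Sum.inr (⟨v, hv⟩, j))‖ ^ 2 := by
      rw [← norm_embedding_eq v x, ← Complex.normSq_eq_norm_sq, Complex.normSq_apply]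
      simp [theta, sq]
    rw [h2]
    refine h1.trans (le_add_of_nonneg_left ?_)
    exact Finset.sum_nonneg fun i _ => by positivity

open scoped Classical in
theorem gaussianWeight_tsum_ne_zero [NumberField K] (σ : ℝ) :
    ∑' x, gaussianWeight K σ x ≠ 0 := by
  rw [ne_eq, ENNReal.tsum_eq_zero]
  intro h
  have := h 0
  simp only [gaussianWeight, ENNReal.ofReal_eq_zero] at this
  exact absurd this (not_le.2 (Real.exp_pos _))

open scoped Classical in
theorem gaussianWeight_tsum_ne_top [NumberField K] {σ : ℝ} (hσ : 0 < σ) :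
    ∑' x, gaussianWeight K σ x ≠ ∞ := by
  suffices h : Summable fun x : 𝓞 K => Real.exp (-‖theta K (x : K)‖ ^ 2 / (2 * σ ^ 2)) by
    simp only [gaussianWeight]
    rw [← ENNReal.ofReal_tsum_of_nonneg (fun _ => (Real.exp_pos _).le) h]
    exact ENNReal.ofReal_ne_top
  have hle : ∀ x : K, ‖mixedEmbedding K x‖ ≤ ‖theta K x‖ := by
    intro x
    rw [norm_eq_sup'_normAtPlace]
    refine Finset.sup'_le _ _ fun v _ => ?_
    rw [normAtPlace_apply]
    exact place_le_norm_theta K v x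
  let L := mixedEmbedding.integerLattice K
  let N := Module.finrank ℤ L + 1
  have hL := ZLattice.summable_norm_pow_inv L (2 * N) (by omega)
  let φ : 𝓞 K → L := fun x => ⟨mixedEmbedding K (x : K), ⟨x, rfl⟩⟩
  have hφ : Function.Injective φ := by
    intro x y hxy
    have h1 : mixedEmbedding K (x : K) = mixedEmbedding K (y : K) := congrArg Subtype.val hxy
    exact RingOfIntegers.ext (mixedEmbedding_injective K h1)
  have hS := (hL.comp_injective hφ).mul_left ((N.factorial : ℝ) * (2 * σ ^ 2) ^ N)
  refine Summable.of_norm_bounded_eventually hS ?_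
  refine Set.Finite.subset (Set.finite_singleton (0 : 𝓞 K)) fun x hx => ?_
  by_contra hx0
  refine hx ?_
  have hx1 : mixedEmbedding K (x : K) ≠ 0 := by
    rw [ne_eq, map_eq_zero]
    exact fun h => hx0 (RingOfIntegers.ext h)
  have ht : 0 < ‖mixedEmbedding K (x : K)‖ := norm_pos_iff.2 hx1
  have hb := hle (x : K)
  set t := ‖mixedEmbedding K (x : K)‖ with htdef
  have hφn : ‖φ x‖ = t := rfl
  simp only [Set.mem_ofPred_eq, Function.comp, hφn]
  rw [Real.norm_of_nonneg (Real.exp_pos _).le]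
  set y := t ^ 2 / (2 * σ ^ 2) with hy
  have hy0 : 0 < y := by positivity
  have h2 : -‖theta K (x : K)‖ ^ 2 / (2 * σ ^ 2) ≤ -y := by
    rw [hy, neg_div]
    gcongr
  have h3 := Real.pow_div_factorial_le_exp y hy0.le N
  calc Real.exp (-‖theta K (x : K)‖ ^ 2 / (2 * σ ^ 2)) ≤ Real.exp (-y) := Real.exp_le_exp.2 h2
    _ = (Real.exp y)⁻¹ := Real.exp_neg y
    _ ≤ (y ^ N / N.factorial)⁻¹ := by gcongr
    _ = (N.factorial : ℝ) * (2 * σ ^ 2) ^ N * t⁻¹ ^ (2 * N) := by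
      rw [hy, inv_div, div_pow, div_div_eq_mul_div, inv_pow, pow_mul]
      ring


/-- The discrete Gaussian distribution of parameter `σ` on the lattice `θ(𝓞 K)`, as a distribution
on `𝓞 K`. -/
noncomputable def discreteGaussian [NumberField K] (σ : ℝ) (hσ : 0 < σ) : PMF (𝓞 K) :=
  PMF.normalize (gaussianWeight K σ) (gaussianWeight_tsum_ne_zero K σ)
    (gaussianWeight_tsum_ne_top K hσ)

end Embedding

/-! ### Non-dual Ring-LWE samples -/

section RingLWE

variable (K : Type*) [Field K] [NumberField K] (q : ℕ)

/-- `R_q = R / qR` for `R = 𝓞 K`. -/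
abbrev Rq : Type _ := 𝓞 K ⧸ Ideal.span {(q : 𝓞 K)}

noncomputable instance [NeZero q] : Fintype (Rq K q) :=
  have : Finite (Rq K q) := Ideal.finiteQuotientOfFreeOfNeBot _ (by
    rw [ne_eq, Ideal.span_singleton_eq_bot]
    exact_mod_cast NeZero.ne q)
  Fintype.ofFinite _

/-- One non-dual Ring-LWE sample `(a, a s + e)` with secret `s`: `a` is uniform in `R_q` and `e` is
drawn independently from the discrete Gaussian on `R`. -/
noncomputable def lweSample [NeZero q] (σ : ℝ) (hσ : 0 < σ) (s : Rq K q) : PMF (Rq K q × Rq K q) :=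
  (PMF.uniformOfFintype (Rq K q)).bind fun a =>
    (discreteGaussian K σ hσ).map fun e => (a, a * s + Ideal.Quotient.mk _ e)

/-- One uniformly random sample from `R_q × R_q`. -/
noncomputable def uniformSample [NeZero q] : PMF (Rq K q × Rq K q) :=
  PMF.uniformOfFintype (Rq K q × Rq K q)

/-- `m` independent draws from a distribution `P`. -/
noncomputable def iidSamples {α : Type*} [Fintype α] (P : PMF α) (m : ℕ) : PMF (Fin m → α) :=
  PMF.ofFintype (fun d => ∏ i, P (d i)) (by
    classical
    have h : ∑ a, P a = 1 := (tsum_fintype (fun a => P a)).symm.trans P.tsum_coe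
    have := (Finset.prod_univ_sum (fun _ : Fin m => (Finset.univ : Finset α))
      (fun _ a => P a)).symm
    rw [Fintype.piFinset_univ] at this
    rw [this]
    simp [h])

variable {K} {q}

/-- The element of `R_q` with coefficient vector `v` with respect to `1, β, …, β^(n-1)`. -/
noncomputable def ofCoeffs (β : 𝓞 K) (n : ℕ) (v : Fin n → ZMod q) : Rq K q :=
  ∑ j, ((v j).val : Rq K q) * (Ideal.Quotient.mk _ β) ^ (j : ℕ)

/-- The coefficient vector of an element of `R_q` with respect to `1, β, …, β^(n-1)`: the inverse of
`ofCoeffs`, which is a bijection when these powers are an integral basis. -/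
noncomputable def toCoeffs (β : 𝓞 K) (n : ℕ) : Rq K q → (Fin n → ZMod q) :=
  Function.invFun (ofCoeffs β n)

end RingLWE

/-! ### A random access machine with logarithmic (bit) cost -/

namespace RAM

/-- The memory: an infinite array of natural numbers. -/
abbrev Mem := ℕ → ℕ

/-- Expressions.  `load a` is the content of the memory cell whose address is the value of `a`. -/
inductive Expr
  | const (c : ℕ)
  | load (a : Expr)
  | add (a b : Expr)
  | sub (a b : Expr)
  | mul (a b : Expr)
  | div (a b : Expr)
  | mod (a b : Expr)

/-- The value of an expression (with truncated subtraction and integer division). -/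
def Expr.eval (s : Mem) : Expr → ℕ
  | const c => c
  | load a => s (a.eval s)
  | add a b => a.eval s + b.eval s
  | sub a b => a.eval s - b.eval s
  | mul a b => a.eval s * b.eval s
  | div a b => a.eval s / b.eval s
  | mod a b => a.eval s % b.eval s

/-- The number of bit operations for evaluating an expression: a memory access is charged the bit
lengths of the address and of the content, an addition or subtraction the bit lengths of the
operands, and a multiplication or division the product of the bit lengths. -/
def Expr.cost (s : Mem) : Expr → ℕ
  | const c => 1 + c.size
  | load a => a.cost s + 1 + (a.eval s).size + (s (a.eval s)).size
  | add a b => a.cost s + b.cost s + 1 + (a.eval s).size + (b.eval s).size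
  | sub a b => a.cost s + b.cost s + 1 + (a.eval s).size + (b.eval s).size
  | mul a b => a.cost s + b.cost s + (1 + (a.eval s).size) * (1 + (b.eval s).size)
  | div a b => a.cost s + b.cost s + (1 + (a.eval s).size) * (1 + (b.eval s).size)
  | mod a b => a.cost s + b.cost s + (1 + (a.eval s).size) * (1 + (b.eval s).size)

/-- Programs.  `store a e` writes the value of `e` into the cell whose address is the value of `a`;
a condition holds when its value is nonzero. -/
inductive Prog
  | skip
  | store (a e : Expr)
  | seq (c d : Prog)
  | ite (e : Expr) (c d : Prog)
  | while (e : Expr) (c : Prog)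

/-- `Exec c s t s'`: the program `c`, started in memory `s`, halts after `t` bit operations in
memory `s'`. -/
inductive Exec : Prog → Mem → ℕ → Mem → Prop
  | skip (s : Mem) : Exec Prog.skip s 1 s
  | store (a e : Expr) (s : Mem) :
      Exec (Prog.store a e) s
        (a.cost s + e.cost s + 1 + (a.eval s).size + (e.eval s).size)
        (Function.update s (a.eval s) (e.eval s))
  | seq {c d : Prog} {s s' s'' : Mem} {t t' : ℕ} :
      Exec c s t s' → Exec d s' t' s'' → Exec (Prog.seq c d) s (t + t') s''
  | ite_true {e : Expr} {c d : Prog} {s s' : Mem} {t : ℕ} :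
      e.eval s ≠ 0 → Exec c s t s' → Exec (Prog.ite e c d) s (e.cost s + 1 + t) s'
  | ite_false {e : Expr} {c d : Prog} {s s' : Mem} {t : ℕ} :
      e.eval s = 0 → Exec d s t s' → Exec (Prog.ite e c d) s (e.cost s + 1 + t) s'
  | while_true {e : Expr} {c : Prog} {s s' s'' : Mem} {t t' : ℕ} :
      e.eval s ≠ 0 → Exec c s t s' → Exec (Prog.while e c) s' t' s'' →
      Exec (Prog.while e c) s (e.cost s + 1 + t + t') s''
  | while_false {e : Expr} {c : Prog} {s : Mem} :
      e.eval s = 0 → Exec (Prog.while e c) s (e.cost s + 1) s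

/-- The initial memory for a list of input words: the `k`-th word is in cell `2k + 1`, and all other
cells hold `0`. -/
def initMem (input : List ℕ) : Mem := fun a => if a % 2 = 1 then input.getD (a / 2) 0 else 0

/-- The program halts on the input within `T` bit operations, with answer `0` or `1` in cell `0`. -/
def DecidesIn (c : Prog) (input : List ℕ) (T : ℕ) : Prop :=
  ∃ t s, Exec c (initMem input) t s ∧ t ≤ T ∧ (s 0 = 0 ∨ s 0 = 1)

/-- The program halts on the input with the given answer in cell `0`. -/
def Answers (c : Prog) (input : List ℕ) (answer : ℕ) : Prop :=
  ∃ t s, Exec c (initMem input) t s ∧ s 0 = answer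

end RAM

/-- The input words for a dataset of `m` pairs of coefficient vectors over `ZMod q`: the numbers
`n`, `q`, `m`, followed by the coefficients of `a₁`, `b₁`, `a₂`, `b₂`, …, each reduced to
`{0, …, q - 1}`. -/
def inputWords (n q m : ℕ) (d : Fin m → (Fin n → ZMod q) × (Fin n → ZMod q)) : List ℕ :=
  [n, q, m] ++ (List.ofFn d).flatMap fun ab =>
    List.ofFn (fun j => (ab.1 j).val) ++ List.ofFn (fun j => (ab.2 j).val)

/-- The input words for a dataset of `m` elements of `R_q × R_q`. -/
noncomputable def datasetWords {K : Type*} [Field K] [NumberField K] {q : ℕ} (β : 𝓞 K) (n m : ℕ)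
    (d : Fin m → Rq K q × Rq K q) : List ℕ :=
  inputWords n q m fun i => (toCoeffs β n (d i).1, toCoeffs β n (d i).2)

/-! ### The family of polynomials and the quantity `τ` -/

/-- `f_{n,q}(x) = x^n + q - 1`. -/
noncomputable def familyPoly (n q : ℕ) : Polynomial ℤ :=
  Polynomial.X ^ n + Polynomial.C ((q : ℤ) - 1)

/-- `τ = q / (2 √2 w n (q - 1)^(1/2 - 1/(2n)))`. -/
noncomputable def tau (n q : ℕ) (w : ℝ) : ℝ :=
  (q : ℝ) / (2 * Real.sqrt 2 * w * n * ((q : ℝ) - 1) ^ ((1 : ℝ) / 2 - 1 / (2 * (n : ℝ))))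

/-!
The distinguisher rests on the ring homomorphism `R_q → ZMod q` with `β ↦ 1`, which exists because
`f_{n,q}(1) = q` (`exists_evalOne`).  It maps a Ring-LWE sample `(a, a s + e)` to
`(a(1), a(1) s(1) + e(1))`, and `e(1)`, the sum of the coefficients of `e`, is small.  So the
program evaluates all samples once and then tests for every `g` in `ZMod q` whether more than three
quarters of the residues `b(1) + g a(1)` lie in `(-q/4, q/4)`.

*Arithmetic.*  Modulo `p` the polynomial `f_{n,q}` is `(x - (1 - q))^n`, so condition 3 makes
`f_{n,q}(x + 1 - q)` Eisenstein at `p`; this gives irreducibility and the degree.  As the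
discriminant is `± n^n (q - 1)^(n-1)` and `f_{n,q}` is Eisenstein at the primes dividing the
squarefree number `q - 1`, the order `ℤ[β]` is maximal (`adjoin_eq_top`).

*Geometry.*  All conjugates of `β` have absolute value `(q - 1)^(1/n)`, and the powers `β^i` with
`0 < i < n` have trace zero.  Hence the vectors `θ(β^j)` are orthogonal once complex coordinates are
counted twice (`gram_gen_pow`).  This gives the determinant, with `64 π σ² < q²` as the meaning of
`τ > 1` (`sq_lt_of_one_lt_tau`), and a vector `u` with `‖u‖² ≤ 2` such that `e(1) = ⟨u, θ(e)⟩`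
(`exists_inner_eq_one`).

*Tails.*  A Gaussian has its largest mass on a lattice when it is centred at a lattice point
(`gaussianSum_le_zero`).  This is usually read off from Poisson summation, but it also follows from
the parallelogram law.  By completing the square the discrete Gaussian is subgaussian, and
`|e(1)| ≥ q/4` has probability at most `2 exp (-π) ≤ 1/10`.  A uniform residue is small with
probability at most `3/5`.  Exponential moments of the counts (`iidSamples_count_mul_le`) and a union
bound over the `q` guesses then show that `32 (ℓ + log₂ q)` samples suffice.

*Running time.*  The program makes `O(m n + q m)` steps on numbers that are polynomial in
`N = ℓ max(n, q)`, so each step costs `O((log N)²)` (`RAM.runs_attack`, `steps_bound`).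
-/

/-! ### The field `ℚ(β)` and its ring of integers -/

section Arithmetic

open Polynomial

theorem familyPoly_monic {n : ℕ} (hn : n ≠ 0) (q : ℕ) : (familyPoly n q).Monic :=
  monic_X_pow_add_C _ hn

theorem familyPoly_natDegree (n q : ℕ) : (familyPoly n q).natDegree = n :=
  natDegree_X_pow_add_C

theorem familyPoly_isEisensteinAt {n q : ℕ} (hn : n ≠ 0) {l : ℤ} (hl : Prime l)
    (h1 : l ∣ (q : ℤ) - 1) (h2 : ¬ l ^ 2 ∣ (q : ℤ) - 1) :
    (familyPoly n q).IsEisensteinAt (Ideal.span {l}) where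
  leading := by
    rw [(familyPoly_monic hn q).leadingCoeff, Ideal.mem_span_singleton]
    exact hl.not_dvd_one
  mem := by
    intro i hi
    rw [familyPoly_natDegree] at hi
    rw [Ideal.mem_span_singleton, familyPoly, coeff_add, coeff_X_pow, if_neg hi.ne, zero_add,
      coeff_C]
    split_ifs
    · exact h1
    · exact dvd_zero _
  notMem := by
    rw [Ideal.span_singleton_pow, Ideal.mem_span_singleton, familyPoly]
    simpa [coeff_X_pow, hn.symm] using h2

theorem familyPoly_comp_monic {n : ℕ} (hn : n ≠ 0) (q : ℕ) (c : ℤ) :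
    ((familyPoly n q).comp (X + C c)).Monic :=
  (familyPoly_monic hn q).comp (monic_X_add_C c) (by rw [natDegree_X_add_C]; exact one_ne_zero)

theorem familyPoly_comp_natDegree (n q : ℕ) (c : ℤ) :
    ((familyPoly n q).comp (X + C c)).natDegree = n := by
  rw [natDegree_comp, familyPoly_natDegree, natDegree_X_add_C, mul_one]

/-- Modulo `p` the polynomial `x^n + q - 1` is `(x - (1 - q))^n`, because `n` is a power of `p`; so
the substitution `x ↦ x + (1 - q)` gives an Eisenstein polynomial as soon as `p²` does not divide
the constant coefficient. -/
theorem familyPoly_comp_isEisensteinAt {p r q : ℕ} (hp : p.Prime)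
    (h : ¬ (p : ℤ) ^ 2 ∣ (1 - (q : ℤ)) ^ (p ^ r) - (1 - (q : ℤ))) :
    ((familyPoly (p ^ r) q).comp (X + C (1 - (q : ℤ)))).IsEisensteinAt
      (Ideal.span {(p : ℤ)}) where
  leading := by
    rw [(familyPoly_comp_monic (pow_ne_zero _ hp.ne_zero) q _).leadingCoeff,
      Ideal.mem_span_singleton]
    exact (Nat.prime_iff_prime_int.1 hp).not_dvd_one
  mem := by
    intro i hi
    rw [familyPoly_comp_natDegree] at hi
    rw [Ideal.mem_span_singleton, ← ZMod.intCast_zmod_eq_zero_iff_dvd _ p]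
    have := Fact.mk hp
    have key : (((familyPoly (p ^ r) q).comp (X + C (1 - (q : ℤ)))).map
        (Int.castRingHom (ZMod p))) = X ^ (p ^ r) := by
      rw [familyPoly, Polynomial.map_comp]
      simp only [Polynomial.map_add, Polynomial.map_pow, map_X, map_C, add_comp, X_comp, pow_comp,
        C_comp]
      rw [add_pow_char_pow, ← C_pow, ← map_pow, map_pow, ZMod.pow_card_pow, add_assoc, ← C_add,
        ← map_add]
      simp
    have h2 := congrArg (fun P => P.coeff i) key
    simpa [coeff_X_pow, hi.ne] using h2
  notMem := by
    have h0 : ((familyPoly (p ^ r) q).comp (X + C (1 - (q : ℤ)))).coeff 0 =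
        (1 - (q : ℤ)) ^ (p ^ r) - (1 - (q : ℤ)) := by
      rw [coeff_zero_eq_eval_zero, eval_comp, familyPoly]
      simp only [eval_add, eval_X, eval_C, eval_pow]
      ring
    rw [Ideal.span_singleton_pow, Ideal.mem_span_singleton, h0]
    exact h

theorem minpoly_eq_of_isEisensteinAt {S : Type*} [CommRing S] [IsDomain S] [CharZero S]
    {x : S} {P : ℤ[X]} {l : ℤ} (hl : Prime l)
    (hP : P.IsEisensteinAt (Ideal.span {l})) (hm : P.Monic) (hd : 0 < P.natDegree)
    (hx : aeval x P = 0) : minpoly ℤ x = P := by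
  have hint : IsIntegral ℤ x := ⟨P, hm, hx⟩
  have hirr := hP.irreducible ((Ideal.span_singleton_prime hl.ne_zero).2 hl) hm.isPrimitive hd
  have hdvd := minpoly.isIntegrallyClosed_dvd hint hx
  exact eq_of_monic_of_associated (minpoly.monic hint) hm
    ((hirr.dvd_iff.1 hdvd).resolve_left (minpoly.not_isUnit ℤ x)).symm

/-- If `A` can be saturated (inside `Z`) at each prime divisor of `D`, then it can be saturated at
`D`.  It is used for `A = ℤ[β]` and `Z` the algebraic integers. -/
theorem mem_of_forall_prime_smul_mem {M : Type*} [AddCommGroup M] (A : AddSubgroup M) (D : ℕ)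
    (hD : D ≠ 0) (Z : Set M) (hZ : ∀ z ∈ Z, ∀ k : ℕ, k • z ∈ Z)
    (h : ∀ l : ℕ, l.Prime → l ∣ D → ∀ z ∈ Z, l • z ∈ A → z ∈ A) :
    ∀ z ∈ Z, D • z ∈ A → z ∈ A := by
  induction D using Nat.recOnMul with
  | zero => exact absurd rfl hD
  | one => simp
  | prime l hl => exact h l hl dvd_rfl
  | mul a b ha hb =>
    intro z hz hab
    rw [mul_smul] at hab
    refine hb (right_ne_zero_of_mul hD) (fun l hl hd => h l hl (hd.mul_left _)) z hz ?_
    exact ha (left_ne_zero_of_mul hD) (fun l hl hd => h l hl (hd.mul_right _)) _ (hZ z hz b) hab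

theorem familyPoly_comp_aeval {S : Type*} [CommRing S] {n q : ℕ} {x : S}
    (hx : aeval x (familyPoly n q) = 0) (c : ℤ) :
    aeval (x - (c : S)) ((familyPoly n q).comp (X + C c)) = 0 := by
  rw [aeval_comp]
  simpa using hx

theorem minpoly_eq_familyPoly {S : Type*} [CommRing S] [IsDomain S] [CharZero S] {p r q : ℕ}
    (hp : p.Prime)
    (h : ¬ (p : ℤ) ^ 2 ∣ (1 - (q : ℤ)) ^ (p ^ r) - (1 - (q : ℤ)))
    {x : S} (hx : aeval x (familyPoly (p ^ r) q) = 0) :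
    minpoly ℤ x = familyPoly (p ^ r) q := by
  have hn := pow_ne_zero r hp.ne_zero
  have hpp := Nat.prime_iff_prime_int.1 hp
  have hE := familyPoly_comp_isEisensteinAt hp h
  have hirr : Irreducible ((familyPoly (p ^ r) q).comp (X + C (1 - (q : ℤ)))) :=
    hE.irreducible ((Ideal.span_singleton_prime hpp.ne_zero).2 hpp)
      (familyPoly_comp_monic hn q _).isPrimitive
      (by rw [familyPoly_comp_natDegree]; exact Nat.pos_of_ne_zero hn)
  have hirr' : Irreducible (familyPoly (p ^ r) q) := by
    rw [← MulEquiv.irreducible_iff (algEquivAevalXAddC (1 - (q : ℤ)))]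
    exact hirr
  have hint : IsIntegral ℤ x := ⟨_, familyPoly_monic hn q, hx⟩
  exact eq_of_monic_of_associated (minpoly.monic hint) (familyPoly_monic hn q)
    ((hirr'.dvd_iff.1 (minpoly.isIntegrallyClosed_dvd hint hx)).resolve_left
      (minpoly.not_isUnit ℤ x)).symm

variable {K : Type*} [Field K]

theorem aeval_coe_familyPoly {n q : ℕ} {β : 𝓞 K} (hβ : aeval β (familyPoly n q) = 0) :
    aeval (β : K) (familyPoly n q) = 0 := by
  have := congrArg (algebraMap (𝓞 K) K) hβ
  rwa [map_zero, ← aeval_algebraMap_apply] at this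

theorem gen_pow_eq {n q : ℕ} {β : 𝓞 K} (hβ : aeval β (familyPoly n q) = 0) :
    (β : K) ^ n = 1 - (q : K) := by
  have := aeval_coe_familyPoly hβ
  rw [familyPoly] at this
  simp only [map_add, map_pow, aeval_X, map_sub, map_one, map_natCast] at this
  linear_combination this

variable [NumberField K]

theorem adjoin_rat_eq_top {x : K} (hx : IntermediateField.adjoin ℚ {x} = ⊤) :
    Algebra.adjoin ℚ {x} = ⊤ := by
  have h := IntermediateField.adjoin_simple_toSubalgebra_of_isAlgebraic
    (Algebra.IsAlgebraic.isAlgebraic (R := ℚ) x)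
  rw [← h, hx, IntermediateField.top_toSubalgebra]

theorem minpoly_rat_eq {p r q : ℕ} (hp : p.Prime)
    (h : ¬ (p : ℤ) ^ 2 ∣ (1 - (q : ℤ)) ^ (p ^ r) - (1 - (q : ℤ))) {β : 𝓞 K}
    (hβ : aeval β (familyPoly (p ^ r) q) = 0) :
    minpoly ℚ (β : K) = X ^ (p ^ r) + C ((q : ℚ) - 1) := by
  rw [minpoly.isIntegrallyClosed_eq_field_fractions' ℚ β.isIntegral_coe,
    minpoly_eq_familyPoly hp h (aeval_coe_familyPoly hβ), familyPoly]
  simp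

theorem finrank_eq {p r q : ℕ} (hp : p.Prime)
    (h : ¬ (p : ℤ) ^ 2 ∣ (1 - (q : ℤ)) ^ (p ^ r) - (1 - (q : ℤ))) {β : 𝓞 K}
    (hβ : aeval β (familyPoly (p ^ r) q) = 0)
    (hK : IntermediateField.adjoin ℚ {(β : K)} = ⊤) :
    Module.finrank ℚ K = p ^ r := by
  rw [← IntermediateField.finrank_top', ← hK,
    IntermediateField.adjoin.finrank (Algebra.IsIntegral.isIntegral _), minpoly_rat_eq hp h hβ,
    natDegree_X_pow_add_C]

theorem abs_norm_gen {p r q : ℕ} (hp : p.Prime) (hq : 1 ≤ q)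
    (h : ¬ (p : ℤ) ^ 2 ∣ (1 - (q : ℤ)) ^ (p ^ r) - (1 - (q : ℤ))) {β : 𝓞 K}
    (hβ : aeval β (familyPoly (p ^ r) q) = 0)
    (hK : IntermediateField.adjoin ℚ {(β : K)} = ⊤) :
    |Algebra.norm ℚ (β : K)| = ((q - 1 : ℕ) : ℚ) := by
  let B := PowerBasis.ofAdjoinEqTop (Algebra.IsIntegral.isIntegral (R := ℚ) (β : K))
    (adjoin_rat_eq_top hK)
  have h1 := Algebra.PowerBasis.norm_gen_eq_coeff_zero_minpoly B
  have h2 : B.gen = (β : K) := PowerBasis.ofAdjoinEqTop_gen _ _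
  rw [h2, minpoly_rat_eq hp h hβ] at h1
  rw [h1, abs_mul, abs_pow, abs_neg, abs_one, one_pow, one_mul]
  have h3 : (0 : ℚ) ≤ (q : ℚ) - 1 := by
    rw [sub_nonneg]; exact_mod_cast hq
  simp [coeff_X_pow, (pow_ne_zero r hp.ne_zero).symm, Nat.cast_sub hq, abs_of_nonneg h3]

/-- The discriminant of `1, β, …, β^(n-1)` is `± n^n (q-1)^(n-1)`, so only the primes `p` and those
dividing `q - 1` can divide the index of `ℤ[β]` in the ring of integers. -/
theorem discr_smul_mem_adjoin {p r q : ℕ} (hp : p.Prime) (hq : 1 ≤ q)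
    (h : ¬ (p : ℤ) ^ 2 ∣ (1 - (q : ℤ)) ^ (p ^ r) - (1 - (q : ℤ))) {β : 𝓞 K}
    (hβ : aeval β (familyPoly (p ^ r) q) = 0)
    (hK : IntermediateField.adjoin ℚ {(β : K)} = ⊤) {z : K} (hz : IsIntegral ℤ z) :
    ((p ^ r) ^ (p ^ r) * (q - 1) ^ (p ^ r - 1) : ℕ) • z ∈ Algebra.adjoin ℤ {(β : K)} := by
  let B := PowerBasis.ofAdjoinEqTop (Algebra.IsIntegral.isIntegral (R := ℚ) (β : K))
    (adjoin_rat_eq_top hK)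
  have h2 : B.gen = (β : K) := PowerBasis.ofAdjoinEqTop_gen _ _
  have h1 := Algebra.discr_mul_isIntegral_mem_adjoin (K := ℚ) (R := ℤ) (B := B)
    (by rw [h2]; exact β.isIntegral_coe) hz
  have h3 : |Algebra.discr ℚ B.basis| = ((p ^ r) ^ (p ^ r) * (q - 1) ^ (p ^ r - 1) : ℕ) := by
    have hder : aeval (β : K) (derivative (X ^ (p ^ r) + C ((q : ℚ) - 1))) =
        algebraMap ℚ K ((p ^ r : ℕ) : ℚ) * (β : K) ^ (p ^ r - 1) := by
      rw [derivative_add, derivative_C, add_zero, derivative_X_pow]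
      simp
    rw [Algebra.discr_powerBasis_eq_norm, h2, minpoly_rat_eq hp h hβ, hder, map_mul, map_pow,
      Algebra.norm_algebraMap, finrank_eq hp h hβ hK]
    simp only [abs_mul, abs_pow, abs_neg, abs_one, one_pow, one_mul,
      abs_norm_gen hp hq h hβ hK, Nat.abs_cast]
    push_cast
    ring
  rw [h2] at h1
  rw [← Nat.cast_smul_eq_nsmul ℚ, ← h3]
  rcases abs_choice (Algebra.discr ℚ B.basis) with h4 | h4
  · rwa [h4]
  · rw [h4, neg_smul]
    exact neg_mem h1

/-- `ℤ[β]` is the full ring of integers: the shifted polynomial is Eisenstein at `p`, and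
`f_{n,q}` itself at the primes dividing the squarefree number `q - 1`. -/
theorem adjoin_eq_top {p r q : ℕ} (hp : p.Prime) (hq : 2 ≤ q)
    (hsq : Squarefree (q - 1))
    (h : ¬ (p : ℤ) ^ 2 ∣ (1 - (q : ℤ)) ^ (p ^ r) - (1 - (q : ℤ))) {β : 𝓞 K}
    (hβ : aeval β (familyPoly (p ^ r) q) = 0)
    (hK : IntermediateField.adjoin ℚ {(β : K)} = ⊤) :
    Algebra.adjoin ℤ {β} = ⊤ := by
  have hn := pow_ne_zero r hp.ne_zero
  have hpp := Nat.prime_iff_prime_int.1 hp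
  have hβK := aeval_coe_familyPoly hβ
  have hshift : Algebra.adjoin ℤ {(β : K) - ((1 - (q : ℤ) : ℤ) : K)} =
      Algebra.adjoin ℤ {(β : K)} := by
    refine le_antisymm (Algebra.adjoin_singleton_le ?_) (Algebra.adjoin_singleton_le ?_)
    · exact sub_mem (Algebra.self_mem_adjoin_singleton _ _) (intCast_mem _ _)
    · have := add_mem (Algebra.self_mem_adjoin_singleton ℤ ((β : K) - ((1 - (q : ℤ) : ℤ) : K)))
        (intCast_mem (Algebra.adjoin ℤ {(β : K) - ((1 - (q : ℤ) : ℤ) : K)}) (1 - (q : ℤ)))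
      rwa [sub_add_cancel] at this
  have key : ∀ z : K, IsIntegral ℤ z → z ∈ Algebra.adjoin ℤ {(β : K)} := by
    intro z hz
    refine mem_of_forall_prime_smul_mem (Algebra.adjoin ℤ {(β : K)}).toSubring.toAddSubgroup
      ((p ^ r) ^ (p ^ r) * (q - 1) ^ (p ^ r - 1))
      (mul_ne_zero (pow_ne_zero _ hn) (pow_ne_zero _ (by omega))) {z | IsIntegral ℤ z}
      (fun z hz k => ?_) ?_ z hz (discr_smul_mem_adjoin hp (by omega) h hβ hK hz)
    · exact hz.smul k
    intro l hl hd z hz hlz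
    have hll := Nat.prime_iff_prime_int.1 hl
    rw [Nat.Prime.dvd_mul hl] at hd
    rcases hd with hd | hd
    · have hlp : l = p := (Nat.prime_dvd_prime_iff_eq hl hp).1
        (hl.dvd_of_dvd_pow (hl.dvd_of_dvd_pow hd))
      subst hlp
      have hγ := familyPoly_comp_aeval hβK (1 - (q : ℤ))
      have hE := familyPoly_comp_isEisensteinAt hp h
      have hmin := minpoly_eq_of_isEisensteinAt hll hE (familyPoly_comp_monic hn q _)
        (by rw [familyPoly_comp_natDegree]; exact Nat.pos_of_ne_zero hn) hγ
      have hint : IsIntegral ℤ ((β : K) - ((1 - (q : ℤ) : ℤ) : K)) :=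
        ⟨_, familyPoly_comp_monic hn q _, hγ⟩
      have htop : Algebra.adjoin ℚ {(β : K) - ((1 - (q : ℤ) : ℤ) : K)} = ⊤ := by
        rw [← top_le_iff, ← adjoin_rat_eq_top hK]
        refine Algebra.adjoin_singleton_le ?_
        have := add_mem
          (Algebra.self_mem_adjoin_singleton ℚ ((β : K) - ((1 - (q : ℤ) : ℤ) : K)))
          (intCast_mem (Algebra.adjoin ℚ {(β : K) - ((1 - (q : ℤ) : ℤ) : K)}) (1 - (q : ℤ)))
        rwa [sub_add_cancel] at this
      let B := PowerBasis.ofAdjoinEqTop (Algebra.IsIntegral.isIntegral (R := ℚ) _) htop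
      have h2 : B.gen = (β : K) - ((1 - (q : ℤ) : ℤ) : K) := PowerBasis.ofAdjoinEqTop_gen _ _
      have := mem_adjoin_of_smul_prime_smul_of_minpoly_isEisensteinAt (K := ℚ) (B := B) hll
        (by rw [h2]; exact hint) hz (by rw [h2, hshift]; simpa using hlz)
        (by rw [h2, hmin]; exact hE)
      rw [h2, hshift] at this
      exact this
    · have hlq : l ∣ q - 1 := hl.dvd_of_dvd_pow hd
      have hlq2 : ¬ l ^ 2 ∣ q - 1 := by
        intro h4
        rw [sq] at h4
        exact hl.one_lt.ne' (Nat.isUnit_iff.1 (hsq l h4))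
      have hcast : (q : ℤ) - 1 = ((q - 1 : ℕ) : ℤ) := by
        rw [Nat.cast_sub (by omega), Nat.cast_one]
      have hE := familyPoly_isEisensteinAt hn hll (q := q) (by rw [hcast]; exact_mod_cast hlq)
        (by rw [hcast]; exact_mod_cast hlq2)
      have hmin := minpoly_eq_of_isEisensteinAt hll hE (familyPoly_monic hn q)
        (by rw [familyPoly_natDegree]; exact Nat.pos_of_ne_zero hn) hβK
      let B := PowerBasis.ofAdjoinEqTop (Algebra.IsIntegral.isIntegral (R := ℚ) _)
        (adjoin_rat_eq_top hK)
      have h2 : B.gen = (β : K) := PowerBasis.ofAdjoinEqTop_gen _ _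
      have := mem_adjoin_of_smul_prime_smul_of_minpoly_isEisensteinAt (K := ℚ) (B := B) hll
        (by rw [h2]; exact β.isIntegral_coe) hz (by rw [h2]; simpa using hlz)
        (by rw [h2, hmin]; exact hE)
      rw [h2] at this
      exact this
  rw [eq_top_iff]
  intro x _
  have hx := key x x.isIntegral_coe
  rw [Algebra.adjoin_singleton_eq_range_aeval] at hx ⊢
  obtain ⟨P, hP⟩ := hx
  refine ⟨P, RingOfIntegers.ext ?_⟩
  rw [← hP]
  exact (aeval_algebraMap_apply K β P).symm

/-- Multiplication by `β^i` moves every vector of the basis `1, β, …, β^(n-1)` to a multiple of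
another one, so its trace vanishes. -/
theorem trace_gen_pow {p r q : ℕ} (hp : p.Prime)
    (h : ¬ (p : ℤ) ^ 2 ∣ (1 - (q : ℤ)) ^ (p ^ r) - (1 - (q : ℤ))) {β : 𝓞 K}
    (hβ : aeval β (familyPoly (p ^ r) q) = 0)
    (hK : IntermediateField.adjoin ℚ {(β : K)} = ⊤) {i : ℕ} (h0 : 0 < i) (hi : i < p ^ r) :
    Algebra.trace ℚ K ((β : K) ^ i) = 0 := by
  let B := PowerBasis.ofAdjoinEqTop (Algebra.IsIntegral.isIntegral (R := ℚ) (β : K))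
    (adjoin_rat_eq_top hK)
  have h2 : B.gen = (β : K) := PowerBasis.ofAdjoinEqTop_gen _ _
  have hdim : B.dim = p ^ r := by rw [← B.finrank, finrank_eq hp h hβ hK]
  rw [Algebra.trace_eq_matrix_trace B.basis, Matrix.trace]
  refine Finset.sum_eq_zero fun j _ => ?_
  have hpow : ∀ k : Fin B.dim, (β : K) ^ (k : ℕ) = B.basis k := fun k => by
    rw [B.basis_eq_pow, h2]
  rw [Matrix.diag_apply, Algebra.leftMulMatrix_eq_repr_mul, ← hpow j, ← pow_add]
  by_cases hij : i + j < B.dim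
  · have := hpow ⟨i + j, hij⟩
    simp only at this
    rw [this, B.basis.repr_self, Finsupp.single_apply, if_neg]
    rw [Fin.ext_iff]
    simp only
    omega
  · have hlt : i + j - p ^ r < B.dim := by omega
    have := hpow ⟨i + j - p ^ r, hlt⟩
    simp only at this
    have he : (β : K) ^ (i + (j : ℕ)) = (1 - (q : ℚ)) • B.basis ⟨i + j - p ^ r, hlt⟩ := by
      rw [← this, Algebra.smul_def, map_sub, map_one, map_natCast, ← gen_pow_eq hβ, ← pow_add]
      congr 1
      omega
    rw [he, map_smul, Finsupp.smul_apply, B.basis.repr_self, Finsupp.single_apply, if_neg,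
      smul_zero]
    rw [Fin.ext_iff]
    simp only
    omega

end Arithmetic

/-! ### The geometry of the lattice `θ(ℤ[β])` -/

section Geometry

open scoped Classical

variable {K : Type*} [Field K]

/-- The multiplicity of a coordinate of `θ`: `1` at a real place and `2` at a complex place. -/
def coordWeight : index K → ℝ := Sum.elim (fun _ => 1) (fun _ => 2)

theorem one_le_coordWeight (i : index K) : 1 ≤ coordWeight i := by
  rcases i with i | i <;> norm_num [coordWeight]

theorem coordWeight_le_two (i : index K) : coordWeight i ≤ 2 := by
  rcases i with i | i <;> norm_num [coordWeight]

variable [NumberField K]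

theorem theta_add (x y : K) : theta K (x + y) = theta K x + theta K y := by
  ext i
  rcases i with v | ⟨v, j⟩
  · simp [theta]
  · by_cases hj : j = 0 <;> simp [theta, hj]

/-- The canonical embedding of the ring of integers, as a homomorphism of groups. -/
noncomputable def thetaHom (K : Type*) [Field K] [NumberField K] :
    𝓞 K →+ EuclideanSpace ℝ (index K) :=
  AddMonoidHom.mk' (fun x => theta K (x : K)) fun x y => by
    rw [← theta_add]; rfl

@[simp]
theorem thetaHom_apply (x : 𝓞 K) : thetaHom K x = theta K (x : K) := rfl

/-- With the complex coordinates counted twice, the Euclidean product of `θ(x)` and `θ(y)` is the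
sum of `conj (φ x) * φ y` over all complex embeddings `φ`. -/
theorem sum_coordWeight_mul (x y : K) :
    ((∑ i, coordWeight i * (theta K x i * theta K y i) : ℝ) : ℂ) =
      ∑ φ : K →+* ℂ, (starRingEnd ℂ) (φ x) * φ y := by
  rw [← Equiv.sum_comp (indexEquiv K), Fintype.sum_sum_type, Fintype.sum_sum_type,
    Fintype.sum_prod_type, Fintype.sum_prod_type]
  push_cast
  congr 1
  · refine Finset.sum_congr rfl fun v _ => ?_
    simp only [coordWeight, theta, Sum.elim_inl, indexEquiv_apply_isReal]
    rw [← embedding_of_isReal_apply v.2, ← embedding_of_isReal_apply v.2, Complex.conj_ofReal]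
    push_cast
    ring
  · refine Finset.sum_congr rfl fun v _ => ?_
    rw [Fin.sum_univ_two, Fin.sum_univ_two]
    simp only [coordWeight, theta, Sum.elim_inr, indexEquiv_apply_isComplex_fst,
      indexEquiv_apply_isComplex_snd, ComplexEmbedding.conjugate_coe_eq]
    apply Complex.ext <;> simp <;> ring

theorem sum_embeddings_eq_trace (x : K) :
    ∑ φ : K →+* ℂ, φ x = ((Algebra.trace ℚ K x : ℚ) : ℂ) := by
  have h := trace_eq_sum_embeddings (K := ℚ) (L := K) ℂ (x := x)
  rw [eq_ratCast] at h
  rw [h, Fintype.sum_equiv (RingHom.equivRatAlgHom K ℂ) (fun f => f x) (fun f => f x)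
    fun _ => by simp [RingHom.equivRatAlgHom_apply]]

theorem norm_embedding_pow {n q : ℕ} (hq : 2 ≤ q) {b : K} (hb : b ^ n = 1 - (q : K))
    (φ : K →+* ℂ) : ‖φ b‖ ^ n = (q : ℝ) - 1 := by
  rw [← norm_pow, ← map_pow, hb, map_sub, map_one, map_natCast, norm_sub_rev]
  have h : ((q : ℂ) - 1) = ((q - 1 : ℕ) : ℂ) := by
    rw [Nat.cast_sub (by omega), Nat.cast_one]
  rw [h, Complex.norm_natCast, Nat.cast_sub (by omega), Nat.cast_one]

/-- All conjugates of a root of `x^n + q - 1` have the same absolute value; this is its square. -/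
noncomputable def conjRadiusSq (n q : ℕ) : ℝ := ((q : ℝ) - 1) ^ ((2 : ℝ) / n)

theorem one_le_conjRadiusSq {n q : ℕ} (hq : 2 ≤ q) : 1 ≤ conjRadiusSq n q := by
  refine Real.one_le_rpow ?_ (by positivity)
  have : (2 : ℝ) ≤ q := by exact_mod_cast hq
  linarith

theorem conjRadiusSq_pow {n q : ℕ} (hn : n ≠ 0) (hq : 2 ≤ q) :
    conjRadiusSq n q ^ n = ((q : ℝ) - 1) ^ 2 := by
  have : (2 : ℝ) ≤ q := by exact_mod_cast hq
  rw [conjRadiusSq, ← Real.rpow_natCast, ← Real.rpow_mul (by linarith),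
    div_mul_cancel₀ _ (by exact_mod_cast hn), ← Real.rpow_natCast]
  norm_num

theorem norm_embedding_sq {n q : ℕ} (hn : n ≠ 0) (hq : 2 ≤ q) {b : K} (hb : b ^ n = 1 - (q : K))
    (φ : K →+* ℂ) : ‖φ b‖ ^ 2 = conjRadiusSq n q := by
  refine (pow_left_inj₀ (by positivity) (by linarith [one_le_conjRadiusSq (n := n) hq]) hn).1 ?_
  rw [conjRadiusSq_pow hn hq, ← norm_embedding_pow hq hb φ]
  ring

/-- The vectors `θ(1), θ(β), …, θ(β^(n-1))` are orthogonal once the complex coordinates are counted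
twice. -/
theorem gram_gen_pow {n q : ℕ} (hfr : Module.finrank ℚ K = n) (hn : n ≠ 0) (hq : 2 ≤ q) {b : K}
    (hb : b ^ n = 1 - (q : K))
    (htr : ∀ i, 0 < i → i < n → Algebra.trace ℚ K (b ^ i) = 0) {j k : ℕ} (hj : j < n) (hk : k < n) :
    ∑ i, coordWeight i * (theta K (b ^ j) i * theta K (b ^ k) i) =
      if j = k then n * conjRadiusSq n q ^ j else 0 := by
  wlog hjk : j ≤ k generalizing j k
  · have := this hk hj (le_of_not_ge hjk)
    simp only [mul_comm (theta K (b ^ j) _)]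
    rw [this, if_neg (by omega), if_neg (by omega)]
  have h1 : ∀ φ : K →+* ℂ, (starRingEnd ℂ) (φ (b ^ j)) * φ (b ^ k) =
      ((conjRadiusSq n q ^ j : ℝ) : ℂ) * φ (b ^ (k - j)) := by
    intro φ
    have h2 : (starRingEnd ℂ) (φ b) * φ b = (conjRadiusSq n q : ℂ) := by
      rw [mul_comm, Complex.mul_conj, Complex.normSq_eq_norm_sq, norm_embedding_sq hn hq hb]
    obtain ⟨d, rfl⟩ := Nat.exists_eq_add_of_le hjk
    rw [Nat.add_sub_cancel_left, pow_add, map_mul, ← mul_assoc, map_pow, map_pow, ← mul_pow, h2]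
    push_cast
    rfl
  have h3 := sum_coordWeight_mul (b ^ j) (b ^ k)
  rw [Finset.sum_congr rfl fun φ _ => h1 φ, ← Finset.mul_sum, sum_embeddings_eq_trace] at h3
  split_ifs with h
  · subst h
    rw [Nat.sub_self, pow_zero, ← map_one (algebraMap ℚ K), Algebra.trace_algebraMap, hfr] at h3
    apply Complex.ofReal_injective
    rw [h3]
    push_cast
    simp [mul_comm]
  · rw [htr _ (by omega) (by omega)] at h3
    apply Complex.ofReal_injective
    rw [h3]
    simp

theorem card_index : Fintype.card (index K) = Module.finrank ℚ K := by
  rw [Fintype.card_congr (indexEquiv K), Embeddings.card]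

theorem equivFin_lt {n : ℕ} (hfr : Module.finrank ℚ K = n) (j : index K) :
    ((Fintype.equivFin (index K)) j : ℕ) < n := by
  rw [← hfr, ← card_index]
  exact ((Fintype.equivFin (index K)) j).2

theorem prod_equivFin {n : ℕ} (hfr : Module.finrank ℚ K = n) {M : Type*} [CommMonoid M]
    (f : ℕ → M) :
    ∏ j : index K, f ((Fintype.equivFin (index K)) j) = ∏ k ∈ Finset.range n, f k := by
  rw [Equiv.prod_comp (Fintype.equivFin (index K)) (fun k => f k), Fin.prod_univ_eq_prod_range,
    card_index, hfr]

/-- `M_βᵀ D M_β` is diagonal, where `D` counts the complex coordinates twice. -/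
theorem transpose_mul_embeddingMatrix {n q : ℕ} (hfr : Module.finrank ℚ K = n) (hn : n ≠ 0)
    (hq : 2 ≤ q) {β : 𝓞 K} (hb : (β : K) ^ n = 1 - (q : K))
    (htr : ∀ i, 0 < i → i < n → Algebra.trace ℚ K ((β : K) ^ i) = 0) :
    (embeddingMatrix β).transpose * Matrix.diagonal coordWeight * embeddingMatrix β =
      Matrix.diagonal fun j => n * conjRadiusSq n q ^ ((Fintype.equivFin (index K)) j : ℕ) := by
  ext j k
  rw [Matrix.mul_apply]
  simp only [Matrix.mul_diagonal, Matrix.transpose_apply, embeddingMatrix, Matrix.of_apply]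
  have := gram_gen_pow hfr hn hq hb htr (equivFin_lt hfr j) (equivFin_lt hfr k)
  rw [Matrix.diagonal_apply]
  simp only [← Fin.ext_iff, EmbeddingLike.apply_eq_iff_eq] at this
  rw [← this]
  refine Finset.sum_congr rfl fun i _ => by ring

theorem det_sq_mul {n q : ℕ} (hfr : Module.finrank ℚ K = n) (hn : n ≠ 0)
    (hq : 2 ≤ q) {β : 𝓞 K} (hb : (β : K) ^ n = 1 - (q : K))
    (htr : ∀ i, 0 < i → i < n → Algebra.trace ℚ K ((β : K) ^ i) = 0) :
    (embeddingMatrix β).det ^ 2 * ∏ i : index K, coordWeight i =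
      (n : ℝ) ^ n * ((q : ℝ) - 1) ^ (n - 1) := by
  have h := congrArg Matrix.det (transpose_mul_embeddingMatrix hfr hn hq hb htr)
  rw [Matrix.det_mul, Matrix.det_mul, Matrix.det_transpose, Matrix.det_diagonal,
    Matrix.det_diagonal, prod_equivFin hfr (fun k => (n : ℝ) * conjRadiusSq n q ^ k),
    Finset.prod_mul_distrib, Finset.prod_const, Finset.card_range, Finset.prod_pow_eq_pow_sum] at h
  have h2 : conjRadiusSq n q ^ (∑ k ∈ Finset.range n, k) = ((q : ℝ) - 1) ^ (n - 1) := by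
    have hq' : (2 : ℝ) ≤ q := by exact_mod_cast hq
    have hR := one_le_conjRadiusSq (n := n) hq
    refine (pow_left_inj₀ (by positivity) (pow_nonneg (by linarith) _) two_ne_zero).1 ?_
    rw [← pow_mul, Finset.sum_range_id_mul_two, pow_mul, conjRadiusSq_pow hn hq, ← pow_mul,
      ← pow_mul, mul_comm]
  rw [← h2, ← h]
  ring

/-- In degree at most `3` there is a complex place: otherwise the trace of `β²`, which is not
positive, would be a sum of nonzero squares. -/
theorem four_le_prod_coordWeight {n q : ℕ} (hfr : Module.finrank ℚ K = n) (hn : 2 ≤ n)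
    (hq : 2 ≤ q) {β : 𝓞 K} (hb : (β : K) ^ n = 1 - (q : K))
    (htr : ∀ i, 0 < i → i < n → Algebra.trace ℚ K ((β : K) ^ i) = 0) :
    4 ≤ ∏ i : index K, (coordWeight i : ℝ) := by
  rw [Fintype.prod_sum_type]
  simp only [coordWeight, Sum.elim_inl, Sum.elim_inr, Finset.prod_const_one, one_mul,
    Finset.prod_const, Finset.card_univ, Fintype.card_prod, Fintype.card_fin]
  suffices h : 0 < Fintype.card {w : InfinitePlace K // IsComplex w} by
    calc (4 : ℝ) = 2 ^ (1 * 2) := by norm_num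
      _ ≤ _ := pow_le_pow_right₀ (by norm_num) (Nat.mul_le_mul_right 2 h)
  by_contra h0
  have hempty : IsEmpty {w : InfinitePlace K // IsComplex w} :=
    Fintype.card_eq_zero_iff.1 (by omega)
  have hb0 : (β : K) ≠ 0 := by
    intro h
    rw [h, zero_pow (by omega), eq_comm, sub_eq_zero] at hb
    have : q = 1 := by exact_mod_cast hb.symm
    omega
  have hreal : ∀ v : InfinitePlace K, IsReal v := fun v =>
    (isReal_or_isComplex v).resolve_right fun hv => hempty.false ⟨v, hv⟩
  have hsum : ((Algebra.trace ℚ K ((β : K) ^ 2) : ℚ) : ℂ) =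
      ((∑ v : {w : InfinitePlace K // IsReal w}, (embedding_of_isReal v.2 (β : K)) ^ 2 : ℝ) : ℂ) := by
    rw [← sum_embeddings_eq_trace, ← Equiv.sum_comp (indexEquiv K), Fintype.sum_sum_type,
      Finset.univ_eq_empty (α := {w : InfinitePlace K // IsComplex w} × Fin 2), Finset.sum_empty,
      add_zero]
    push_cast
    refine Finset.sum_congr rfl fun v _ => ?_
    rw [indexEquiv_apply_isReal, map_pow, embedding_of_isReal_apply]
  have hsum' : ((Algebra.trace ℚ K ((β : K) ^ 2) : ℚ) : ℝ) =
      ∑ v : {w : InfinitePlace K // IsReal w}, (embedding_of_isReal v.2 (β : K)) ^ 2 := by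
    exact_mod_cast hsum
  have hne : Nonempty (InfinitePlace K) := inferInstance
  obtain ⟨v⟩ := hne
  have hpos : 0 < ∑ v : {w : InfinitePlace K // IsReal w},
      (embedding_of_isReal v.2 (β : K)) ^ 2 := by
    refine Finset.sum_pos (fun w _ => ?_) ⟨⟨v, hreal v⟩, Finset.mem_univ _⟩
    have : embedding_of_isReal w.2 (β : K) ≠ 0 := (map_ne_zero _).2 hb0
    positivity
  rw [← hsum'] at hpos
  rcases hn.eq_or_lt with h2 | h2
  · rw [← h2] at hb hfr
    have h3 : (β : K) ^ 2 = algebraMap ℚ K (1 - (q : ℚ)) := by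
      rw [hb]; simp
    rw [h3, Algebra.trace_algebraMap, hfr] at hpos
    have hq' : (2 : ℝ) ≤ q := by exact_mod_cast hq
    norm_num at hpos
    linarith
  · rw [htr 2 (by norm_num) h2] at hpos
    simp at hpos

theorem det_embeddingMatrix_ne_zero {n q : ℕ} (hfr : Module.finrank ℚ K = n) (hn : n ≠ 0)
    (hq : 2 ≤ q) {β : 𝓞 K} (hb : (β : K) ^ n = 1 - (q : K))
    (htr : ∀ i, 0 < i → i < n → Algebra.trace ℚ K ((β : K) ^ i) = 0) :
    (embeddingMatrix β).det ≠ 0 := by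
  intro h
  have h1 := det_sq_mul hfr hn hq hb htr
  have hq' : (2 : ℝ) ≤ q := by exact_mod_cast hq
  have hn' : (0 : ℝ) < n := by exact_mod_cast Nat.pos_of_ne_zero hn
  have : 0 < (n : ℝ) ^ n * ((q : ℝ) - 1) ^ (n - 1) :=
    mul_pos (by positivity) (pow_pos (by linarith) _)
  rw [h] at h1
  simp at h1
  linarith

/-- The determinant bound behind the constant `2√2` of `τ`: `|det M_β|^(1/n)` is at most
`(n / 2) (q - 1)^(1/2 - 1/(2n))`. -/
theorem detRoot_le {n q : ℕ} (hfr : Module.finrank ℚ K = n) (hn : 2 ≤ n)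
    (hq : 2 ≤ q) {β : 𝓞 K} (hb : (β : K) ^ n = 1 - (q : K))
    (htr : ∀ i, 0 < i → i < n → Algebra.trace ℚ K ((β : K) ^ i) = 0) :
    detRoot β ≤ n / 2 * ((q : ℝ) - 1) ^ ((1 : ℝ) / 2 - 1 / (2 * (n : ℝ))) := by
  have hn0 : n ≠ 0 := by omega
  have hq' : (2 : ℝ) ≤ q := by exact_mod_cast hq
  have hn' : (2 : ℝ) ≤ n := by exact_mod_cast hn
  set y := (n : ℝ) / 2 * ((q : ℝ) - 1) ^ ((1 : ℝ) / 2 - 1 / (2 * (n : ℝ))) with hy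
  have hy0 : 0 ≤ y := mul_nonneg (by positivity) (Real.rpow_nonneg (by linarith) _)
  have hpow : (y ^ n) ^ 2 = ((n : ℝ) / 2) ^ (2 * n) * ((q : ℝ) - 1) ^ (n - 1) := by
    rw [← pow_mul, mul_comm n 2, hy, mul_pow, ← Real.rpow_mul_natCast (by linarith)]
    congr 1
    rw [← Real.rpow_natCast]
    congr 1
    rw [Nat.cast_sub (by omega)]
    push_cast
    field_simp
  -- for `n ≥ 4` this holds without complex places; they are needed for `n = 2` and `n = 3`
  have hW : (4 : ℝ) ^ n ≤ (∏ i : index K, coordWeight i) * (n : ℝ) ^ n := by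
    have h4 := four_le_prod_coordWeight hfr hn hq hb htr
    rcases lt_or_ge n 4 with h | h
    · have h5 : (4 : ℝ) ^ n ≤ 4 * (n : ℝ) ^ n := by
        have : n = 2 ∨ n = 3 := by omega
        rcases this with rfl | rfl <;> norm_num
      exact h5.trans (mul_le_mul_of_nonneg_right h4 (by positivity))
    · have h5 : (4 : ℝ) ^ n ≤ (n : ℝ) ^ n :=
        pow_le_pow_left₀ (by norm_num) (by exact_mod_cast h) n
      exact h5.trans (le_mul_of_one_le_left (by positivity) (by linarith))
  have hdet : |(embeddingMatrix β).det| ≤ y ^ n := by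
    refine abs_le_of_sq_le_sq ?_ (pow_nonneg hy0 n)
    have h1 := det_sq_mul hfr hn0 hq hb htr
    set W := ∏ i : index K, (coordWeight i : ℝ)
    have hWpos : 0 < W := by linarith [four_le_prod_coordWeight hfr hn hq hb htr]
    refine le_of_mul_le_mul_right ?_ hWpos
    rw [h1, hpow]
    have hA : (0 : ℝ) ≤ ((q : ℝ) - 1) ^ (n - 1) := pow_nonneg (by linarith) _
    have h6 : (n : ℝ) ^ n ≤ ((n : ℝ) / 2) ^ (2 * n) * W := by
      rw [pow_mul, div_pow, div_pow, div_mul_eq_mul_div, le_div_iff₀ (by positivity)]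
      calc (n : ℝ) ^ n * (2 ^ 2) ^ n = n ^ n * 4 ^ n := by norm_num
        _ ≤ n ^ n * (W * n ^ n) := by gcongr
        _ = _ := by ring
    calc (n : ℝ) ^ n * ((q : ℝ) - 1) ^ (n - 1)
        ≤ ((n : ℝ) / 2) ^ (2 * n) * W * ((q : ℝ) - 1) ^ (n - 1) :=
          mul_le_mul_of_nonneg_right h6 hA
      _ = _ := by ring
  rw [detRoot, hfr]
  calc |(embeddingMatrix β).det| ^ ((1 : ℝ) / n) ≤ (y ^ n) ^ ((1 : ℝ) / n) :=
        Real.rpow_le_rpow (abs_nonneg _) hdet (by positivity)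
    _ = y := by rw [one_div, Real.pow_rpow_inv_natCast hy0 hn0]

theorem detRoot_pos {n q : ℕ} (hfr : Module.finrank ℚ K = n) (hn : n ≠ 0)
    (hq : 2 ≤ q) {β : 𝓞 K} (hb : (β : K) ^ n = 1 - (q : K))
    (htr : ∀ i, 0 < i → i < n → Algebra.trace ℚ K ((β : K) ^ i) = 0) : 0 < detRoot β :=
  Real.rpow_pos_of_pos (abs_pos.2 (det_embeddingMatrix_ne_zero hfr hn hq hb htr)) _

/-- The hypothesis `τ > 1` makes `q / 4` large against `σ`. -/
theorem sq_lt_of_one_lt_tau {n q : ℕ} (hfr : Module.finrank ℚ K = n) (hn : 2 ≤ n)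
    (hq : 2 ≤ q) {β : 𝓞 K} (hb : (β : K) ^ n = 1 - (q : K))
    (htr : ∀ i, 0 < i → i < n → Algebra.trace ℚ K ((β : K) ^ i) = 0) {σ : ℝ} (hσ : 0 < σ)
    (hτ : 1 < tau n q (gaussianWidth β σ)) : 64 * Real.pi * σ ^ 2 < (q : ℝ) ^ 2 := by
  have hd := detRoot_pos hfr (by omega) hq hb htr
  have hle := detRoot_le hfr hn hq hb htr
  have hq' : (2 : ℝ) ≤ q := by exact_mod_cast hq
  have hn' : (2 : ℝ) ≤ n := by exact_mod_cast hn
  have hA : 0 < ((q : ℝ) - 1) ^ ((1 : ℝ) / 2 - 1 / (2 * (n : ℝ))) :=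
    Real.rpow_pos_of_pos (by linarith) _
  rw [tau, gaussianWidth] at hτ
  set A := ((q : ℝ) - 1) ^ ((1 : ℝ) / 2 - 1 / (2 * (n : ℝ)))
  set d := detRoot β
  have hpi := Real.pi_pos
  rw [one_lt_div (by positivity)] at hτ
  have h1 : 4 * Real.sqrt 2 * Real.sqrt (2 * Real.pi) * σ ≤
      2 * Real.sqrt 2 * (Real.sqrt (2 * Real.pi) * (σ / d)) * n * A := by
    have h2 : 2 ≤ n * A / d := by
      rw [le_div_iff₀ hd]
      linarith
    calc 4 * Real.sqrt 2 * Real.sqrt (2 * Real.pi) * σ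
        = 2 * Real.sqrt 2 * Real.sqrt (2 * Real.pi) * σ * 2 := by ring
      _ ≤ 2 * Real.sqrt 2 * Real.sqrt (2 * Real.pi) * σ * (n * A / d) := by gcongr
      _ = _ := by ring
  have h3 := h1.trans_lt hτ
  have h4 := pow_lt_pow_left₀ h3 (by positivity) two_ne_zero
  have h5 : (4 * Real.sqrt 2 * Real.sqrt (2 * Real.pi) * σ) ^ 2 = 64 * Real.pi * σ ^ 2 := by
    rw [mul_pow, mul_pow, mul_pow, Real.sq_sqrt (by norm_num), Real.sq_sqrt (by positivity)]
    ring
  linarith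

/-- Evaluation at `β ↦ 1` is a linear form on the lattice; the vector representing it is short,
because the `θ(β^k)` are orthogonal up to the weights and have length at least `√(n/2)`. -/
theorem exists_inner_eq_one {n q : ℕ} (hfr : Module.finrank ℚ K = n) (hn : n ≠ 0)
    (hq : 2 ≤ q) {b : K} (hb : b ^ n = 1 - (q : K))
    (htr : ∀ i, 0 < i → i < n → Algebra.trace ℚ K (b ^ i) = 0) :
    ∃ u : EuclideanSpace ℝ (index K), ‖u‖ ^ 2 ≤ 2 ∧
      ∀ j < n, inner ℝ u (theta K (b ^ j)) = 1 := by
  have hR := one_le_conjRadiusSq (n := n) hq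
  have hn' : (0 : ℝ) < n := by exact_mod_cast Nat.pos_of_ne_zero hn
  set R := conjRadiusSq n q with hRdef
  let c : ℕ → ℝ := fun k => (n * R ^ k)⁻¹
  let v : index K → ℝ := fun i => ∑ k ∈ Finset.range n, c k * theta K (b ^ k) i
  have hgram : ∀ j < n, ∑ i, coordWeight i * (v i * theta K (b ^ j) i) = 1 := by
    intro j hj
    have h1 : ∀ i, coordWeight i * (v i * theta K (b ^ j) i) =
        ∑ k ∈ Finset.range n,
          c k * (coordWeight i * (theta K (b ^ k) i * theta K (b ^ j) i)) := by
      intro i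
      rw [Finset.sum_mul, Finset.mul_sum]
      exact Finset.sum_congr rfl fun k _ => by ring
    rw [Finset.sum_congr rfl fun i _ => h1 i, Finset.sum_comm]
    rw [Finset.sum_eq_single_of_mem j (Finset.mem_range.2 hj)]
    · rw [← Finset.mul_sum, gram_gen_pow hfr hn hq hb htr hj hj, if_pos rfl]
      exact inv_mul_cancel₀ (by positivity)
    · intro k hk hkj
      rw [← Finset.mul_sum, gram_gen_pow hfr hn hq hb htr (Finset.mem_range.1 hk) hj, if_neg hkj,
        mul_zero]
  refine ⟨WithLp.toLp 2 fun i => coordWeight i * v i, ?_, fun j hj => ?_⟩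
  · rw [EuclideanSpace.norm_sq_eq]
    have h2 : ∑ i, coordWeight i * (v i * v i) = ∑ k ∈ Finset.range n, c k := by
      have h1 : ∀ i, coordWeight i * (v i * v i) =
          ∑ k ∈ Finset.range n, c k * (coordWeight i * (v i * theta K (b ^ k) i)) := by
        intro i
        calc coordWeight i * (v i * v i)
            = coordWeight i * (v i * ∑ k ∈ Finset.range n, c k * theta K (b ^ k) i) := rfl
          _ = _ := by
            rw [Finset.mul_sum, Finset.mul_sum]
            exact Finset.sum_congr rfl fun k _ => by ring
      rw [Finset.sum_congr rfl fun i _ => h1 i, Finset.sum_comm]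
      refine Finset.sum_congr rfl fun k hk => ?_
      rw [← Finset.mul_sum, hgram k (Finset.mem_range.1 hk), mul_one]
    calc ∑ i, ‖coordWeight i * v i‖ ^ 2 ≤ ∑ i, 2 * (coordWeight i * (v i * v i)) := by
          refine Finset.sum_le_sum fun i _ => ?_
          rw [Real.norm_eq_abs, sq_abs]
          have h3 := coordWeight_le_two i
          have h4 := one_le_coordWeight i
          nlinarith [mul_nonneg (mul_nonneg (by linarith : 0 ≤ coordWeight i)
            (by linarith : 0 ≤ 2 - coordWeight i)) (mul_self_nonneg (v i))]
      _ = 2 * ∑ k ∈ Finset.range n, c k := by rw [← Finset.mul_sum, h2]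
      _ ≤ 2 * ∑ k ∈ Finset.range n, (n : ℝ)⁻¹ := by
          gcongr with k hk
          exact inv_anti₀ hn' (le_mul_of_one_le_right hn'.le (one_le_pow₀ hR))
      _ = 2 := by
          rw [Finset.sum_const, Finset.card_range, nsmul_eq_mul, mul_inv_cancel₀ hn'.ne', mul_one]
  · rw [PiLp.inner_apply, ← hgram j hj]
    refine Finset.sum_congr rfl fun i _ => ?_
    simp only [RCLike.inner_apply, conj_trivial]
    ring

/-- Every point of the ambient space is at bounded distance from the lattice `θ(𝓞 K)`. -/
theorem exists_norm_sub_thetaHom_le {β : 𝓞 K} (hdet : (embeddingMatrix β).det ≠ 0) :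
    ∃ R : ℝ, ∀ c : EuclideanSpace ℝ (index K), ∃ x : 𝓞 K, ‖c - thetaHom K x‖ ≤ R := by
  let col : index K → EuclideanSpace ℝ (index K) := fun j =>
    thetaHom K (β ^ ((Fintype.equivFin (index K)) j : ℕ))
  refine ⟨∑ j, ‖col j‖, fun c => ?_⟩
  let y : index K → ℝ := (embeddingMatrix β)⁻¹.mulVec c
  have hy : c = ∑ j, y j • col j := by
    have h1 : (embeddingMatrix β).mulVec y = c := by
      simp only [y]
      rw [Matrix.mulVec_mulVec, Matrix.mul_nonsing_inv _ (Ne.isUnit hdet), Matrix.one_mulVec]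
    ext i
    rw [← congrFun h1 i, Matrix.mulVec, dotProduct, WithLp.ofLp_sum, Finset.sum_apply]
    refine Finset.sum_congr rfl fun j _ => ?_
    simp [embeddingMatrix, col, mul_comm]
  refine ⟨∑ j, ⌊y j⌋ • β ^ ((Fintype.equivFin (index K)) j : ℕ), ?_⟩
  rw [map_sum, hy, ← Finset.sum_sub_distrib]
  refine (norm_sum_le _ _).trans (Finset.sum_le_sum fun j _ => ?_)
  have h2 : y j • col j - thetaHom K (⌊y j⌋ • β ^ ((Fintype.equivFin (index K)) j : ℕ)) =
      Int.fract (y j) • col j := by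
    rw [map_zsmul, ← Int.cast_smul_eq_zsmul ℝ, ← sub_smul, Int.self_sub_floor]
  rw [h2, _root_.norm_smul, Real.norm_of_nonneg (Int.fract_nonneg _)]
  exact mul_le_of_le_one_left (norm_nonneg _) (Int.fract_lt_one _).le

end Geometry

/-! ### Gaussian sums over a lattice -/

section GaussianSum

variable {E : Type*} [NormedAddCommGroup E] {G : Type*} [AddCommGroup G]

/-- The total mass `∑ exp (-a |φ x - c|²)` on the lattice `φ(G)` of a Gaussian centred at `c`. -/
noncomputable def gaussianSum (φ : G →+ E) (a : ℝ) (c : E) : ℝ≥0∞ :=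
  ∑' x, ENNReal.ofReal (Real.exp (-a * ‖φ x - c‖ ^ 2))

theorem gaussianSum_add (φ : G →+ E) (a : ℝ) (c : E) (y : G) :
    gaussianSum φ a (c + φ y) = gaussianSum φ a c := by
  rw [gaussianSum, ← (Equiv.addRight y).tsum_eq]
  refine tsum_congr fun x => ?_
  rw [Equiv.coe_addRight, map_add, add_sub_add_right_eq_sub]

theorem gaussianSum_le_of_norm_le (φ : G →+ E) {a : ℝ} (ha : 0 ≤ a) {c : E} {R : ℝ}
    (hc : ‖c‖ ≤ R) :
    gaussianSum φ a c ≤ ENNReal.ofReal (Real.exp (a * R ^ 2)) * gaussianSum φ (a / 2) 0 := by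
  rw [gaussianSum, gaussianSum, ← ENNReal.tsum_mul_left]
  refine ENNReal.tsum_le_tsum fun x => ?_
  rw [← ENNReal.ofReal_mul (Real.exp_nonneg _), ← Real.exp_add]
  refine ENNReal.ofReal_le_ofReal (Real.exp_le_exp.2 ?_)
  rw [sub_zero]
  have h1 : ‖φ x‖ ≤ ‖φ x - c‖ + R := by
    have := norm_add_le (φ x - c) c
    rw [sub_add_cancel] at this
    linarith
  have h2 : ‖φ x‖ ^ 2 ≤ 2 * ‖φ x - c‖ ^ 2 + 2 * R ^ 2 := by
    nlinarith [norm_nonneg (φ x), sq_nonneg (‖φ x - c‖ - R)]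
  nlinarith

/-- Pairs `(x + y, x - y)` are the pairs of elements that are congruent modulo `2G`. -/
theorem tsum_add_mul_sub (htf : ∀ x y : G, 2 • x = 2 • y → x = y) (f g : G → ℝ≥0∞) :
    ∑' x, ∑' y, f (x + y) * g (x - y) =
      ∑' t : G ⧸ (nsmulAddMonoidHom (α := G) 2).range,
        (∑' p : (QuotientAddGroup.mk (s := (nsmulAddMonoidHom (α := G) 2).range)) ⁻¹' {t}, f p) *
        (∑' p : (QuotientAddGroup.mk (s := (nsmulAddMonoidHom (α := G) 2).range)) ⁻¹' {t}, g p) := by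
  set N := (nsmulAddMonoidHom (α := G) 2).range with hN
  let H : G ⧸ N → ℝ≥0∞ := fun t => ∑' p : (QuotientAddGroup.mk (s := N)) ⁻¹' {t}, g p
  have hfib : ∀ p : G, ∑' y, g (p - 2 • y) = H (QuotientAddGroup.mk p) := by
    intro p
    have hmem : ∀ y : G, p - 2 • y ∈
        (QuotientAddGroup.mk (s := N)) ⁻¹' {(QuotientAddGroup.mk p : G ⧸ N)} := by
      intro y
      rw [Set.mem_preimage, Set.mem_singleton_iff, QuotientAddGroup.eq]
      exact ⟨y, by simp⟩
    let e : G → ((QuotientAddGroup.mk (s := N)) ⁻¹' {(QuotientAddGroup.mk p : G ⧸ N)}) :=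
      fun y => ⟨p - 2 • y, hmem y⟩
    have he : Function.Bijective e := by
      constructor
      · intro y z hyz
        have := congrArg Subtype.val hyz
        simp only [e, sub_right_inj] at this
        exact htf _ _ this
      · rintro ⟨s, hs⟩
        rw [Set.mem_preimage, Set.mem_singleton_iff, QuotientAddGroup.eq] at hs
        obtain ⟨y, hy⟩ := hs
        refine ⟨y, Subtype.ext ?_⟩
        have hy' : 2 • y = -s + p := hy
        simp only [e, hy']
        abel
    exact (Equiv.ofBijective e he).tsum_eq (fun s => g s)
  rw [ENNReal.tsum_comm]
  have h1 : ∀ y, ∑' x, f (x + y) * g (x - y) = ∑' p, f p * g (p - 2 • y) := by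
    intro y
    rw [← (Equiv.addRight y).tsum_eq (fun p => f p * g (p - 2 • y))]
    refine tsum_congr fun x => ?_
    rw [Equiv.coe_addRight, two_nsmul, add_sub_add_right_eq_sub]
  simp only [h1]
  rw [ENNReal.tsum_comm]
  simp only [ENNReal.tsum_mul_left, hfib]
  rw [← ENNReal.tsum_fiberwise (fun p => f p * H (QuotientAddGroup.mk p))
    (QuotientAddGroup.mk (s := N))]
  refine tsum_congr fun t => ?_
  rw [← ENNReal.tsum_mul_right]
  refine tsum_congr fun p => ?_
  have := p.2
  rw [Set.mem_preimage, Set.mem_singleton_iff] at this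
  rw [this]

variable [InnerProductSpace ℝ E]

/-- The parallelogram law turns a product of two Gaussian sums into a sum over `(x + y, x - y)`. -/
theorem gaussianSum_mul_gaussianSum (φ : G →+ E) (a : ℝ) (c d : E) :
    gaussianSum φ a (c + d) * gaussianSum φ a (c - d) =
      ∑' x, ∑' y, ENNReal.ofReal (Real.exp (-(a / 2) * ‖φ (x + y) - (2 : ℝ) • c‖ ^ 2)) *
        ENNReal.ofReal (Real.exp (-(a / 2) * ‖φ (x - y) - (2 : ℝ) • d‖ ^ 2)) := by
  rw [gaussianSum, gaussianSum, ← ENNReal.tsum_mul_right]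
  refine tsum_congr fun x => ?_
  rw [← ENNReal.tsum_mul_left]
  refine tsum_congr fun y => ?_
  rw [← ENNReal.ofReal_mul (Real.exp_nonneg _), ← ENNReal.ofReal_mul (Real.exp_nonneg _),
    ← Real.exp_add, ← Real.exp_add]
  congr 2
  have h := parallelogram_law_with_norm ℝ (φ x - (c + d)) (φ y - (c - d))
  have h1 : φ (x + y) - (2 : ℝ) • c = φ x - (c + d) + (φ y - (c - d)) := by
    rw [map_add, two_smul]; abel
  have h2 : φ (x - y) - (2 : ℝ) • d = φ x - (c + d) - (φ y - (c - d)) := by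
    rw [map_sub, two_smul]; abel
  rw [h1, h2]
  linear_combination (a / 2) * h

theorem two_mul_mul_le_add_sq (x y : ℝ≥0∞) : 2 * (x * y) ≤ x ^ 2 + y ^ 2 := by
  wlog h : x ≤ y generalizing x y
  · rw [mul_comm x, add_comm]
    exact this y x (le_of_not_ge h)
  obtain ⟨d, rfl⟩ := exists_add_of_le h
  have h1 : x ^ 2 + (x + d) ^ 2 = 2 * (x * (x + d)) + d ^ 2 := by ring
  rw [h1]
  exact le_self_add

theorem two_mul_gaussianSum_sq_le (htf : ∀ x y : G, 2 • x = 2 • y → x = y) (φ : G →+ E) (a : ℝ)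
    (c : E) : 2 * gaussianSum φ a c ^ 2 ≤
      gaussianSum φ a ((2 : ℝ) • c) * gaussianSum φ a 0 + gaussianSum φ a 0 ^ 2 := by
  have h1 := gaussianSum_mul_gaussianSum φ a c 0
  have h2 := gaussianSum_mul_gaussianSum φ a c c
  have h3 := gaussianSum_mul_gaussianSum φ a (0 : E) 0
  rw [add_zero, sub_zero, ← sq] at h1
  rw [sub_self, ← two_smul ℝ c] at h2
  rw [add_zero, sub_zero, ← sq] at h3
  rw [tsum_add_mul_sub htf (fun p => ENNReal.ofReal (Real.exp (-(a / 2) * ‖φ p - _‖ ^ 2)))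
    (fun p => ENNReal.ofReal (Real.exp (-(a / 2) * ‖φ p - _‖ ^ 2)))] at h1 h2 h3
  rw [h1, h2, h3, ← ENNReal.tsum_mul_left, ← ENNReal.tsum_add]
  refine ENNReal.tsum_le_tsum fun t => ?_
  rw [← sq, ← sq]
  exact two_mul_mul_le_add_sq _ _

/-- A Gaussian has the largest mass on the lattice when it is centred at a lattice point.  If `S` is
the supremum of the masses `F(c)` then `2 F(c)² ≤ F(2c) F(0) + F(0)²` gives
`2 S² ≤ S F(0) + F(0)²`, that is, `S ≤ F(0)`. -/
theorem gaussianSum_le_zero (htf : ∀ x y : G, 2 • x = 2 • y → x = y) (φ : G →+ E) {a : ℝ}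
    (ha : 0 ≤ a) {R : ℝ} (hR : ∀ c : E, ∃ x : G, ‖c - φ x‖ ≤ R)
    (hfin : gaussianSum φ (a / 2) 0 ≠ ∞) (c : E) :
    gaussianSum φ a c ≤ gaussianSum φ a 0 := by
  set B := ENNReal.ofReal (Real.exp (a * R ^ 2)) * gaussianSum φ (a / 2) 0 with hB
  have hBtop : B ≠ ∞ := ENNReal.mul_ne_top ENNReal.ofReal_ne_top hfin
  have hle : ∀ c, gaussianSum φ a c ≤ B := by
    intro c
    obtain ⟨x, hx⟩ := hR c
    have := gaussianSum_add φ a (c - φ x) x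
    rw [sub_add_cancel] at this
    rw [this]
    exact gaussianSum_le_of_norm_le φ ha hx
  have htop : ∀ c, gaussianSum φ a c ≠ ∞ := fun c => ne_top_of_le_ne_top hBtop (hle c)
  let F : E → ℝ := fun c => (gaussianSum φ a c).toReal
  have hF0 : ∀ c, 0 ≤ F c := fun c => ENNReal.toReal_nonneg
  have hbdd : BddAbove (Set.range F) := by
    refine ⟨B.toReal, ?_⟩
    rintro _ ⟨c, rfl⟩
    exact ENNReal.toReal_mono hBtop (hle c)
  have hFsq : ∀ c, 2 * F c ^ 2 ≤ F ((2 : ℝ) • c) * F 0 + F 0 ^ 2 := by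
    intro c
    have h := ENNReal.toReal_mono (ENNReal.add_ne_top.2 ⟨ENNReal.mul_ne_top (htop _) (htop _),
      ENNReal.pow_ne_top (htop _)⟩) (two_mul_gaussianSum_sq_le htf φ a c)
    rw [ENNReal.toReal_add (ENNReal.mul_ne_top (htop _) (htop _)) (ENNReal.pow_ne_top (htop _))] at h
    simpa using h
  set S := ⨆ c, F c with hS
  have hFS : ∀ c, F c ≤ S := fun c => le_ciSup hbdd c
  have hS0 : 0 ≤ S := (hF0 0).trans (hFS 0)
  have h1 : S ≤ Real.sqrt ((S * F 0 + F 0 ^ 2) / 2) := by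
    refine ciSup_le fun c => Real.le_sqrt_of_sq_le ?_
    have h2 := hFsq c
    have h3 := mul_le_mul_of_nonneg_right (hFS ((2 : ℝ) • c)) (hF0 0)
    linarith
  have h2 : S ^ 2 ≤ (S * F 0 + F 0 ^ 2) / 2 := by
    have h3 : 0 ≤ (S * F 0 + F 0 ^ 2) / 2 := by
      have := mul_nonneg hS0 (hF0 0)
      positivity
    calc S ^ 2 ≤ Real.sqrt ((S * F 0 + F 0 ^ 2) / 2) ^ 2 := pow_le_pow_left₀ hS0 h1 2
      _ = _ := Real.sq_sqrt h3
  have h3 : S ≤ F 0 := by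
    by_contra hlt
    push Not at hlt
    nlinarith [hF0 0]
  exact (ENNReal.toReal_le_toReal (htop _) (htop _)).1 ((hFS c).trans h3)

end GaussianSum

/-! ### Tails of the discrete Gaussian -/

section Tail

open scoped Classical

variable {K : Type*} [Field K] [NumberField K]

theorem gaussianSum_thetaHom {σ : ℝ} :
    gaussianSum (thetaHom K) (1 / (2 * σ ^ 2)) 0 = ∑' x, gaussianWeight K σ x := by
  refine tsum_congr fun x => ?_
  rw [gaussianWeight, thetaHom_apply, sub_zero]
  congr 2
  ring

theorem two_nsmul_injective (x y : 𝓞 K) (h : 2 • x = 2 • y) : x = y := by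
  rw [two_nsmul, two_nsmul, ← two_mul, ← two_mul] at h
  exact mul_left_cancel₀ two_ne_zero h

/-- The discrete Gaussian is subgaussian: its exponential moments are at most those of the
continuous Gaussian. -/
theorem tsum_gaussianWeight_mul_exp_le {R : ℝ}
    (hR : ∀ c : EuclideanSpace ℝ (index K), ∃ x : 𝓞 K, ‖c - thetaHom K x‖ ≤ R) {σ : ℝ} (hσ : 0 < σ)
    (v : EuclideanSpace ℝ (index K)) :
    ∑' x : 𝓞 K, gaussianWeight K σ x * ENNReal.ofReal (Real.exp (inner ℝ v (theta K (x : K)))) ≤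
      ENNReal.ofReal (Real.exp (σ ^ 2 * ‖v‖ ^ 2 / 2)) * ∑' x, gaussianWeight K σ x := by
  have hfin : gaussianSum (thetaHom K) (1 / (2 * σ ^ 2) / 2) 0 ≠ ∞ := by
    have h1 : 1 / (2 * σ ^ 2) / 2 = 1 / (2 * (Real.sqrt 2 * σ) ^ 2) := by
      rw [mul_pow, Real.sq_sqrt (by norm_num)]
      field_simp
    rw [h1, gaussianSum_thetaHom]
    exact gaussianWeight_tsum_ne_top K (by positivity)
  have h := gaussianSum_le_zero two_nsmul_injective (thetaHom K) (by positivity) hR hfin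
    (σ ^ 2 • v)
  rw [gaussianSum_thetaHom] at h
  refine le_trans (le_of_eq ?_) (mul_le_mul_right h _)
  rw [gaussianSum, ← ENNReal.tsum_mul_left]
  refine tsum_congr fun x => ?_
  rw [gaussianWeight, ← ENNReal.ofReal_mul (Real.exp_nonneg _),
    ← ENNReal.ofReal_mul (Real.exp_nonneg _), ← Real.exp_add, ← Real.exp_add]
  congr 2
  rw [norm_sub_sq_real, inner_smul_right, _root_.norm_smul, Real.norm_of_nonneg (by positivity),
    real_inner_comm, thetaHom_apply]
  field_simp
  ring

/-- Chernoff's bound: the exponent `T / (2σ²)` is optimal for `‖u‖² = 2`. -/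
theorem discreteGaussian_inner_ge {R : ℝ}
    (hR : ∀ c : EuclideanSpace ℝ (index K), ∃ x : 𝓞 K, ‖c - thetaHom K x‖ ≤ R) {σ : ℝ} (hσ : 0 < σ)
    {u : EuclideanSpace ℝ (index K)} (hu : ‖u‖ ^ 2 ≤ 2) {T : ℝ} (hT : 0 ≤ T) :
    (discreteGaussian K σ hσ).toOuterMeasure {x | T ≤ inner ℝ u (theta K (x : K))} ≤
      ENNReal.ofReal (Real.exp (-(T ^ 2 / (4 * σ ^ 2)))) := by
  set Z := ∑' x, gaussianWeight K σ x with hZ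
  have hZ0 : Z ≠ 0 := gaussianWeight_tsum_ne_zero K σ
  have hZt : Z ≠ ∞ := gaussianWeight_tsum_ne_top K hσ
  set v := (T / (2 * σ ^ 2)) • u with hv
  have hmgf := tsum_gaussianWeight_mul_exp_le hR hσ v
  set A := {x : 𝓞 K | T ≤ inner ℝ u (theta K (x : K))} with hA
  have hpt : ∀ x : 𝓞 K,
      Set.indicator A (discreteGaussian K σ hσ) x ≤
        ENNReal.ofReal (Real.exp (-(T ^ 2 / (2 * σ ^ 2)))) * (gaussianWeight K σ x *
          ENNReal.ofReal (Real.exp (inner ℝ v (theta K (x : K))))) * Z⁻¹ := by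
    intro x
    by_cases hx : x ∈ A
    · have hx' : T ≤ inner ℝ u (theta K (x : K)) := hx
      rw [Set.indicator_of_mem hx, discreteGaussian, PMF.normalize_apply, ← hZ]
      refine mul_le_mul_left ?_ _
      rw [mul_left_comm, ← ENNReal.ofReal_mul (Real.exp_nonneg _), ← Real.exp_add]
      refine le_mul_of_one_le_right zero_le ?_
      rw [ENNReal.one_le_ofReal, Real.one_le_exp_iff, hv, inner_smul_left]
      simp only [conj_trivial]
      have h1 : T / (2 * σ ^ 2) * T ≤ T / (2 * σ ^ 2) * inner ℝ u (theta K (x : K)) :=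
        mul_le_mul_of_nonneg_left hx' (by positivity)
      have h2 : T / (2 * σ ^ 2) * T = T ^ 2 / (2 * σ ^ 2) := by ring
      linarith
    · rw [Set.indicator_of_notMem hx]
      exact zero_le
  rw [PMF.toOuterMeasure_apply]
  refine (ENNReal.tsum_le_tsum hpt).trans ?_
  rw [ENNReal.tsum_mul_right, ENNReal.tsum_mul_left]
  refine (mul_le_mul_left (mul_le_mul_right hmgf _) _).trans ?_
  rw [mul_assoc, mul_assoc, ENNReal.mul_inv_cancel hZ0 hZt, mul_one,
    ← ENNReal.ofReal_mul (Real.exp_nonneg _), ← Real.exp_add]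
  refine ENNReal.ofReal_le_ofReal (Real.exp_le_exp.2 ?_)
  rw [hv, _root_.norm_smul, Real.norm_of_nonneg (by positivity)]
  have h3 : σ ^ 2 * (T / (2 * σ ^ 2) * ‖u‖) ^ 2 / 2 = T ^ 2 / (8 * σ ^ 2) * ‖u‖ ^ 2 := by
    field_simp
    ring
  have h4 : T ^ 2 / (8 * σ ^ 2) * ‖u‖ ^ 2 ≤ T ^ 2 / (8 * σ ^ 2) * 2 :=
    mul_le_mul_of_nonneg_left hu (by positivity)
  have h5 : T ^ 2 / (8 * σ ^ 2) * 2 = T ^ 2 / (4 * σ ^ 2) := by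
    field_simp; ring
  have h6 : T ^ 2 / (2 * σ ^ 2) = 2 * (T ^ 2 / (4 * σ ^ 2)) := by
    field_simp; ring
  rw [h3, h6]
  linarith

/-- Both tails beyond `q / 4` have mass at most `exp (-π) ≤ 1/20`. -/
theorem discreteGaussian_abs_inner_ge {R : ℝ}
    (hR : ∀ c : EuclideanSpace ℝ (index K), ∃ x : 𝓞 K, ‖c - thetaHom K x‖ ≤ R) {σ : ℝ} (hσ : 0 < σ)
    {u : EuclideanSpace ℝ (index K)} (hu : ‖u‖ ^ 2 ≤ 2) {q : ℕ}
    (hq : 64 * Real.pi * σ ^ 2 < (q : ℝ) ^ 2) :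
    (discreteGaussian K σ hσ).toOuterMeasure {x | (q : ℝ) / 4 ≤ |inner ℝ u (theta K (x : K))|} ≤
      ENNReal.ofReal (1 / 10) := by
  have hexp : Real.exp (-(((q : ℝ) / 4) ^ 2 / (4 * σ ^ 2))) ≤ 1 / 20 := by
    have h1 : 3 ≤ ((q : ℝ) / 4) ^ 2 / (4 * σ ^ 2) := by
      rw [le_div_iff₀ (by positivity)]
      nlinarith [Real.pi_gt_three, sq_nonneg σ]
    have h2 : (20 : ℝ) ≤ Real.exp 3 := by
      have h3 : Real.exp 3 = Real.exp 1 ^ 3 := by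
        rw [← Real.exp_nat_mul]; norm_num
      rw [h3]
      have h4 := Real.exp_one_gt_d9
      calc (20 : ℝ) ≤ 2.718 ^ 3 := by norm_num
        _ ≤ _ := by gcongr; linarith
    rw [Real.exp_neg, one_div]
    exact inv_anti₀ (by norm_num) (h2.trans (Real.exp_le_exp.2 h1))
  have hsub : {x : 𝓞 K | (q : ℝ) / 4 ≤ |inner ℝ u (theta K (x : K))|} ⊆
      {x | (q : ℝ) / 4 ≤ inner ℝ u (theta K (x : K))} ∪
      {x | (q : ℝ) / 4 ≤ inner ℝ (-u) (theta K (x : K))} := by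
    intro x hx
    rw [Set.mem_ofPred_eq, le_abs] at hx
    simpa [inner_neg_left] using hx
  have hT : (0 : ℝ) ≤ (q : ℝ) / 4 := by positivity
  refine ((discreteGaussian K σ hσ).toOuterMeasure.mono hsub).trans ?_
  refine (MeasureTheory.measure_union_le (μ := (discreteGaussian K σ hσ).toOuterMeasure) _ _).trans ?_
  refine (add_le_add (discreteGaussian_inner_ge hR hσ hu hT)
    (discreteGaussian_inner_ge hR hσ (by rwa [norm_neg]) hT)).trans ?_
  rw [← ENNReal.ofReal_add (Real.exp_nonneg _) (Real.exp_nonneg _)]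
  exact ENNReal.ofReal_le_ofReal (by linarith)

end Tail

/-! ### Tail bounds for counts in independent samples -/

section Chernoff

variable {α : Type*}

theorem one_sub_le_of_compl_subset (P : PMF α) {S B : Set α} (h : Sᶜ ⊆ B) :
    1 - P.toOuterMeasure B ≤ P.toOuterMeasure S := by
  rw [tsub_le_iff_right]
  have h1 : P.toOuterMeasure Set.univ = 1 :=
    (P.toOuterMeasure_apply_eq_one_iff _).2 (Set.subset_univ _)
  rw [← h1]
  refine (P.toOuterMeasure.mono ?_).trans
    (MeasureTheory.measure_union_le (μ := P.toOuterMeasure) S B)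
  intro x _
  by_cases hx : x ∈ S
  · exact Or.inl hx
  · exact Or.inr (h hx)

variable [Fintype α]

/-- Markov's inequality for `(w + 1) ^ #{i | A (d i)}`. -/
theorem iidSamples_count_mul_le (P : PMF α) (A : α → Prop) [DecidablePred A]
    (m k w : ℕ) :
    (iidSamples P m).toOuterMeasure {d | k ≤ Finset.card {i | A (d i)}} * ((w : ℝ≥0∞) + 1) ^ k ≤
      (1 + w * P.toOuterMeasure {x | A x}) ^ m := by
  have h1 : ∑ a, P a * (if A a then (w : ℝ≥0∞) + 1 else 1) = 1 + w * P.toOuterMeasure {x | A x} := by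
    have h : ∑ a, P a = 1 := (tsum_fintype (fun a => P a)).symm.trans P.tsum_coe
    rw [PMF.toOuterMeasure_apply_fintype, Finset.mul_sum]
    conv_rhs => rw [← h, ← Finset.sum_add_distrib]
    refine Finset.sum_congr rfl fun a _ => ?_
    by_cases ha : A a
    · rw [if_pos ha, Set.indicator_of_mem (s := {x | A x}) ha]; ring
    · rw [if_neg ha, Set.indicator_of_notMem (s := {x | A x}) ha]; ring
  have h2 : (1 + w * P.toOuterMeasure {x | A x}) ^ m =
      ∑ d : Fin m → α, ∏ i, (P (d i) * (if A (d i) then (w : ℝ≥0∞) + 1 else 1)) := by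
    have := Finset.prod_univ_sum (fun _ : Fin m => (Finset.univ : Finset α))
      (fun _ a => P a * (if A a then (w : ℝ≥0∞) + 1 else 1))
    rw [Fintype.piFinset_univ] at this
    rw [← this, h1, Finset.prod_const, Finset.card_univ, Fintype.card_fin]
  rw [h2, PMF.toOuterMeasure_apply_fintype, Finset.sum_mul]
  refine Finset.sum_le_sum fun d _ => ?_
  rw [Finset.prod_mul_distrib, Finset.prod_ite, Finset.prod_const_one, mul_one, Finset.prod_const]
  by_cases hd : d ∈ {d : Fin m → α | k ≤ Finset.card {i | A (d i)}}
  · rw [Set.indicator_of_mem hd]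
    exact mul_le_mul_right (pow_le_pow_right₀ le_add_self hd) _
  · rw [Set.indicator_of_notMem hd, zero_mul]
    exact zero_le

theorem iidSamples_count_le {P : PMF α} {A : α → Prop} [DecidablePred A]
    {p c : ℝ} {m k w M : ℕ}
    (hp : P.toOuterMeasure {x | A x} ≤ ENNReal.ofReal p) (hp0 : 0 ≤ p)
    (hc : (1 + w * p) ^ m ≤ c ^ M * (w + 1) ^ k) (hc0 : 0 ≤ c) :
    (iidSamples P m).toOuterMeasure {d | k ≤ Finset.card {i | A (d i)}} ≤
      ENNReal.ofReal c ^ M := by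
  have h := (iidSamples_count_mul_le P A m k w).trans
    (pow_le_pow_left' (add_le_add_right (mul_le_mul_right hp (w : ℝ≥0∞)) 1) m)
  have hw : (w : ℝ≥0∞) + 1 = ENNReal.ofReal ((w : ℝ) + 1) := by
    rw [ENNReal.ofReal_add (by positivity) zero_le_one, ENNReal.ofReal_natCast, ENNReal.ofReal_one]
  have h1 : 1 + (w : ℝ≥0∞) * ENNReal.ofReal p = ENNReal.ofReal (1 + w * p) := by
    rw [ENNReal.ofReal_add zero_le_one (by positivity), ENNReal.ofReal_mul (by positivity),
      ENNReal.ofReal_natCast, ENNReal.ofReal_one]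
  rw [h1, hw, ← ENNReal.ofReal_pow (by positivity), ← ENNReal.ofReal_pow (by positivity)] at h
  have h2 := h.trans (ENNReal.ofReal_le_ofReal hc)
  rw [ENNReal.ofReal_mul (by positivity), ENNReal.ofReal_pow hc0] at h2
  refine (ENNReal.mul_le_mul_iff_left ?_ ENNReal.ofReal_ne_top).1 h2
  exact (ENNReal.ofReal_pos.2 (by positivity)).ne'

/-- A surjective homomorphism maps the uniform distribution to the uniform distribution. -/
theorem uniformOfFintype_preimage {A B : Type*} [AddCommGroup A] [AddCommGroup B] [Fintype A]
    [Fintype B] [DecidableEq B] (ψ : A →+ B) (hψ : Function.Surjective ψ) (I : Finset B) :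
    (PMF.uniformOfFintype A).toOuterMeasure {x | ψ x ∈ I} =
      (I.card : ℝ≥0∞) / (Fintype.card B : ℝ≥0∞) := by
  have hfib : ∀ z, (Finset.univ.filter fun x => ψ x = z).card =
      (Finset.univ.filter fun x => ψ x = 0).card := by
    intro z
    obtain ⟨x0, rfl⟩ := hψ z
    refine (Finset.card_equiv (Equiv.addRight x0) fun x => ?_).symm
    simp
  have hcount : ∀ J : Finset B, (Finset.univ.filter fun x => ψ x ∈ J).card =
      J.card * (Finset.univ.filter fun x => ψ x = 0).card := by
    intro J
    rw [Finset.card_eq_sum_card_fiberwise (f := ψ) (t := J) (fun x hx => by simpa using hx),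
      ← smul_eq_mul, ← Finset.sum_const]
    refine Finset.sum_congr rfl fun z hz => ?_
    rw [← hfib z, Finset.filter_filter]
    congr 1
    ext x
    simp only [Finset.mem_filter, Finset.mem_univ, true_and]
    exact ⟨fun h => h.2, fun h => ⟨h ▸ hz, h⟩⟩
  have hall := hcount Finset.univ
  simp only [Finset.mem_univ, Finset.filter_true] at hall
  have h0 : (Finset.univ.filter fun x => ψ x = 0).card ≠ 0 :=
    Finset.card_ne_zero.2 ⟨0, by simp⟩
  have hcard : Fintype.card {x | ψ x ∈ I} = (Finset.univ.filter fun x => ψ x ∈ I).card :=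
    Fintype.card_of_subtype _ fun x => by simp
  rw [PMF.toOuterMeasure_uniformOfFintype_apply, ← Finset.card_univ (α := A), hall, hcard,
    hcount I, Finset.card_univ]
  push_cast
  exact ENNReal.mul_div_mul_right _ _ (by exact_mod_cast h0) (ENNReal.natCast_ne_top _)

end Chernoff

/-! ### Residues close to zero -/

section Small

/-- The residue class `z` modulo `q` has a representative of absolute value less than `q / 4`. -/
def IsSmall {q : ℕ} (z : ZMod q) : Prop :=
  4 * z.val < q ∨ 4 * (q - z.val) < q

instance {q : ℕ} (z : ZMod q) : Decidable (IsSmall z) := inferInstanceAs (Decidable (_ ∨ _))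

theorem isSmall_intCast {q : ℕ} [NeZero q] {t : ℤ} (ht : 4 * |t| < q) : IsSmall (t : ZMod q) := by
  have h := ZMod.val_intCast (n := q) t
  have hlt : ((t : ZMod q).val : ℤ) < q := by exact_mod_cast ZMod.val_lt _
  have hq : (0 : ℤ) < q := by exact_mod_cast NeZero.pos q
  unfold IsSmall
  rcases le_or_gt 0 t with h0 | h0
  · rw [abs_of_nonneg h0] at ht
    rw [Int.emod_eq_of_lt h0 (by omega)] at h
    omega
  · rw [abs_of_neg h0] at ht
    rw [← Int.add_emod_right, Int.emod_eq_of_lt (by omega) (by omega)] at h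
    omega

/-- There are `2 ⌊(q - 1) / 4⌋ + 1` small residues; the worst case is `q = 5`. -/
theorem card_isSmall_le {q : ℕ} [NeZero q] (hq : 2 ≤ q) :
    (Finset.univ.filter fun z : ZMod q => IsSmall z).card * 5 ≤ 3 * q := by
  have h1 : (Finset.univ.filter fun z : ZMod q => IsSmall z).card ≤
      (Finset.range ((q - 1) / 4 + 1) ∪ Finset.Ico (q - (q - 1) / 4) q).card := by
    refine Finset.card_le_card_of_injOn ZMod.val ?_ (ZMod.val_injective q).injOn
    intro z hz
    have hz' : IsSmall z := by simpa using hz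
    have hlt := ZMod.val_lt z
    simp only [Finset.coe_union, Finset.coe_range, Finset.coe_Ico, Set.mem_union, Set.mem_Iio,
      Set.mem_Ico]
    rcases hz' with h | h
    · left; omega
    · right; omega
  have h2 := h1.trans (Finset.card_union_le _ _)
  rw [Finset.card_range, Nat.card_Ico] at h2
  rcases Nat.eq_zero_or_pos ((q - 1) / 4) with h0 | h0 <;> omega

/-- The test: for some guess `-g` of `s(1)`, more than three quarters of the residues
`b(1) - a(1) s(1)` are small. -/
def Accepts {q m : ℕ} (x : Fin m → ZMod q × ZMod q) : Prop :=
  ∃ g : ℕ, g < q ∧ 3 * m < 4 * (Finset.univ.filter fun i =>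
    IsSmall ((x i).2 + (g : ZMod q) * (x i).1)).card

end Small

/-! ### Evaluation at one, and the success probabilities of the test -/

section Evaluation

open Polynomial in
theorem exists_eq_sum_smul_pow {K : Type*} [Field K] [NumberField K] {β : 𝓞 K} {n q : ℕ}
    (hn : n ≠ 0) (hβ : aeval β (familyPoly n q) = 0) (htop : Algebra.adjoin ℤ {β} = ⊤) (x : 𝓞 K) :
    ∃ c : ℕ → ℤ, x = ∑ j ∈ Finset.range n, c j • β ^ j := by
  have hx : x ∈ Algebra.adjoin ℤ {β} := htop ▸ Algebra.mem_top
  rw [Algebra.adjoin_singleton_eq_range_aeval] at hx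
  obtain ⟨P, rfl⟩ := hx
  refine ⟨fun j => (P %ₘ familyPoly n q).coeff j, ?_⟩
  have h1 : (P %ₘ familyPoly n q).natDegree < n := by
    have := natDegree_modByMonic_lt P (familyPoly_monic hn q) (fun h => by
      have h2 := familyPoly_natDegree n q
      rw [h, natDegree_one] at h2
      exact hn h2.symm)
    rwa [familyPoly_natDegree] at this
  rw [← aeval_eq_sum_range' h1]
  change aeval β P = _
  conv_lhs => rw [← modByMonic_add_div P (familyPoly n q)]
  rw [map_add, map_mul, hβ, zero_mul, add_zero]

open Polynomial in
/-- Since `f_{n,q}(1) = q`, there is a ring homomorphism from `R_q` to `ZMod q` with `β ↦ 1`. -/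
theorem exists_evalOne {K : Type*} [Field K] [NumberField K] {β : 𝓞 K} {n q : ℕ}
    (hmin : minpoly ℤ β = familyPoly n q) (htop : Algebra.adjoin ℤ {β} = ⊤) :
    ∃ ev : Rq K q →+* ZMod q, ev (Ideal.Quotient.mk _ β) = 1 := by
  let pb := PowerBasis.ofAdjoinEqTop' (RingOfIntegers.isIntegral β) htop
  have hgen : pb.gen = β := PowerBasis.ofAdjoinEqTop'_gen _ _
  let L := pb.lift (1 : ZMod q) (by
    rw [hgen, hmin, familyPoly]
    simp)
  have hL : L β = 1 := by
    have h : L pb.gen = 1 := pb.lift_gen _ _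
    rwa [hgen] at h
  refine ⟨Ideal.Quotient.lift _ L.toRingHom fun a ha => ?_, ?_⟩
  · rw [Ideal.mem_span_singleton] at ha
    obtain ⟨b, rfl⟩ := ha
    simp
  · rw [Ideal.Quotient.lift_mk]
    exact hL

variable {K : Type*} [Field K] {β : 𝓞 K} {n q : ℕ} [NeZero q]

/-- Surjectivity is what makes `toCoeffs`, defined by `Function.invFun`, a section of `ofCoeffs`. -/
theorem ofCoeffs_surjective
    (hrep : ∀ x : 𝓞 K, ∃ c : ℕ → ℤ, x = ∑ j ∈ Finset.range n, c j • β ^ j) :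
    Function.Surjective (ofCoeffs (q := q) β n) := by
  intro y
  obtain ⟨x, rfl⟩ := Ideal.Quotient.mk_surjective y
  obtain ⟨c, rfl⟩ := hrep x
  refine ⟨fun j => (c j : ZMod q), ?_⟩
  rw [ofCoeffs, map_sum, ← Fin.sum_univ_eq_sum_range
    (fun j => (Ideal.Quotient.mk (Ideal.span {(q : 𝓞 K)})) (c j • β ^ j))]
  refine Finset.sum_congr rfl fun j _ => ?_
  have hq0 : ((q : ℕ) : Rq K q) = 0 := by
    have : Ideal.Quotient.mk (Ideal.span {(q : 𝓞 K)}) (q : 𝓞 K) = 0 :=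
      Ideal.Quotient.eq_zero_iff_mem.2 (Ideal.mem_span_singleton_self _)
    simpa using this
  have h1 : (((c j : ZMod q).val : ℕ) : Rq K q) = ((c j : ℤ) : Rq K q) := by
    have h2 := ZMod.val_intCast (n := q) (c j)
    have h3 := Int.emod_add_mul_ediv (c j) q
    rw [← h2] at h3
    have h4 := congrArg (Int.cast : ℤ → Rq K q) h3
    push_cast at h4
    rwa [hq0, zero_mul, add_zero] at h4
  rw [h1, zsmul_eq_mul, map_mul, map_pow, map_intCast]

theorem evalOne_eq_sum_toCoeffs
    (hrep : ∀ x : 𝓞 K, ∃ c : ℕ → ℤ, x = ∑ j ∈ Finset.range n, c j • β ^ j)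
    {ev : Rq K q →+* ZMod q} (hev : ev (Ideal.Quotient.mk _ β) = 1) (x : Rq K q) :
    ∑ j, toCoeffs β n x j = ev x := by
  conv_rhs => rw [← Function.rightInverse_invFun (ofCoeffs_surjective (β := β) hrep) x]
  rw [ofCoeffs, map_sum]
  refine Finset.sum_congr rfl fun j _ => ?_
  rw [map_mul, map_pow, hev, one_pow, mul_one, map_natCast, ZMod.natCast_zmod_val]
  rfl

variable [NumberField K]

open scoped Classical in
/-- The error reduces to a small residue under evaluation at one, except with small probability. -/
theorem discreteGaussian_not_isSmall
    (hrep : ∀ x : 𝓞 K, ∃ c : ℕ → ℤ, x = ∑ j ∈ Finset.range n, c j • β ^ j)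
    {ev : Rq K q →+* ZMod q} (hev : ev (Ideal.Quotient.mk _ β) = 1) {R : ℝ}
    (hR : ∀ c : EuclideanSpace ℝ (index K), ∃ x : 𝓞 K, ‖c - thetaHom K x‖ ≤ R) {σ : ℝ} (hσ : 0 < σ)
    {u : EuclideanSpace ℝ (index K)} (hu : ‖u‖ ^ 2 ≤ 2)
    (hu1 : ∀ j < n, inner ℝ u (theta K ((β : K) ^ j)) = 1)
    (hq : 64 * Real.pi * σ ^ 2 < (q : ℝ) ^ 2) :
    (discreteGaussian K σ hσ).toOuterMeasure {e | ¬ IsSmall (ev (Ideal.Quotient.mk _ e))} ≤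
      ENNReal.ofReal (1 / 10) := by
  refine le_trans ((discreteGaussian K σ hσ).toOuterMeasure.mono ?_)
    (discreteGaussian_abs_inner_ge hR hσ hu hq)
  intro e he
  by_contra hlt
  refine he ?_
  rw [Set.mem_ofPred_eq, not_le] at hlt
  obtain ⟨c, rfl⟩ := hrep e
  have h1 : inner ℝ u (theta K ((∑ j ∈ Finset.range n, c j • β ^ j : 𝓞 K) : K)) =
      ((∑ j ∈ Finset.range n, c j : ℤ) : ℝ) := by
    rw [← thetaHom_apply, map_sum, inner_sum]
    push_cast
    refine Finset.sum_congr rfl fun j hj => ?_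
    rw [map_zsmul, ← Int.cast_smul_eq_zsmul ℝ, inner_smul_right, thetaHom_apply]
    have h3 : inner ℝ u (theta K ((β ^ j : 𝓞 K) : K)) = 1 := by
      rw [← hu1 j (Finset.mem_range.1 hj)]
      congr 2
    rw [h3, mul_one]
  have h2 : ev (Ideal.Quotient.mk _ (∑ j ∈ Finset.range n, c j • β ^ j)) =
      ((∑ j ∈ Finset.range n, c j : ℤ) : ZMod q) := by
    rw [map_sum, map_sum]
    push_cast
    refine Finset.sum_congr rfl fun j _ => ?_
    rw [zsmul_eq_mul, map_mul, map_mul, map_pow, map_pow, hev, one_pow, mul_one, map_intCast,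
      map_intCast]
  rw [h1] at hlt
  rw [h2]
  refine isSmall_intCast ?_
  have h3 : 4 * |((∑ j ∈ Finset.range n, c j : ℤ) : ℝ)| < q := by linarith
  exact_mod_cast h3

/-- Since `b = a s + e`, the residue `b(1) - a(1) s(1)` is `e(1)`. -/
theorem lweSample_not_isSmall {ev : Rq K q →+* ZMod q} {σ : ℝ} (hσ : 0 < σ)
    (h : (discreteGaussian K σ hσ).toOuterMeasure {e | ¬ IsSmall (ev (Ideal.Quotient.mk _ e))} ≤
      ENNReal.ofReal (1 / 10)) (s : Rq K q) {g : ZMod q} (hg : g = -ev s) :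
    (lweSample K q σ hσ s).toOuterMeasure {x | ¬ IsSmall (ev x.2 + g * ev x.1)} ≤
      ENNReal.ofReal (1 / 10) := by
  rw [lweSample, PMF.toOuterMeasure_bind_apply]
  have h1 : ∀ a : Rq K q, ((discreteGaussian K σ hσ).map fun e =>
      (a, a * s + Ideal.Quotient.mk _ e)).toOuterMeasure {x | ¬ IsSmall (ev x.2 + g * ev x.1)} ≤
      ENNReal.ofReal (1 / 10) := by
    intro a
    rw [PMF.toOuterMeasure_map_apply]
    refine le_trans (le_of_eq ?_) h
    congr 1
    ext e
    simp only [Set.mem_preimage, Set.mem_ofPred_eq, map_add, map_mul, hg]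
    have : ev a * ev s + ev (Ideal.Quotient.mk _ e) + -ev s * ev a =
      ev (Ideal.Quotient.mk _ e) := by ring
    rw [this]
  refine (ENNReal.tsum_le_tsum fun a => mul_le_mul_right (h1 a) _).trans ?_
  rw [ENNReal.tsum_mul_right, PMF.tsum_coe, one_mul]

theorem uniformSample_isSmall (hq : 2 ≤ q) (ev : Rq K q →+* ZMod q) (g : ZMod q) :
    (uniformSample K q).toOuterMeasure {x | IsSmall (ev x.2 + g * ev x.1)} ≤
      ENNReal.ofReal (3 / 5) := by
  let ψ : Rq K q × Rq K q →+ ZMod q :=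
    AddMonoidHom.mk' (fun x => ev x.2 + g * ev x.1) fun x y => by
      simp only [Prod.fst_add, Prod.snd_add, map_add]; ring
  have hψ : Function.Surjective ψ := by
    intro z
    refine ⟨(0, (z.val : Rq K q)), ?_⟩
    change ev _ + g * ev 0 = z
    rw [map_zero, mul_zero, add_zero, map_natCast, ZMod.natCast_zmod_val]
  have h := uniformOfFintype_preimage ψ hψ (Finset.univ.filter fun z => IsSmall z)
  have hset : {x : Rq K q × Rq K q | IsSmall (ev x.2 + g * ev x.1)} =
      {x | ψ x ∈ Finset.univ.filter fun z => IsSmall z} := by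
    ext x
    simp [ψ]
  rw [uniformSample, hset]
  refine le_trans (le_of_eq h) ?_
  rw [ZMod.card]
  have hq0 : (0 : ℝ) < q := by positivity
  rw [← ENNReal.ofReal_natCast, ← ENNReal.ofReal_natCast (n := q), ← ENNReal.ofReal_div_of_pos hq0]
  refine ENNReal.ofReal_le_ofReal ?_
  rw [div_le_div_iff₀ hq0 (by norm_num)]
  exact_mod_cast card_isSmall_le hq

/-- The union bound over `q` guesses costs less than the factor `4 ^ log₂ q`. -/
theorem four_pow_bound (ℓ q : ℕ) (hℓ : 1 ≤ ℓ) :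
    (q : ℝ≥0∞) * ENNReal.ofReal (1 / 4) ^ (ℓ + Nat.log 2 q) ≤ (2 : ℝ≥0∞)⁻¹ ^ ℓ := by
  have h4 : ENNReal.ofReal (1 / 4) = (2 : ℝ≥0∞)⁻¹ * (2 : ℝ≥0∞)⁻¹ := by
    rw [← ENNReal.mul_inv (by norm_num) (by norm_num), one_div,
      ENNReal.ofReal_inv_of_pos (by norm_num)]
    norm_num
  have h2 : (2 : ℝ≥0∞) * 2⁻¹ = 1 := ENNReal.mul_inv_cancel (by norm_num) (by norm_num)
  have hlt : q ≤ 2 ^ (ℓ + Nat.log 2 q) :=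
    (Nat.lt_pow_succ_log_self (by norm_num) q).le.trans
      (Nat.pow_le_pow_right (by norm_num) (by omega))
  calc (q : ℝ≥0∞) * ENNReal.ofReal (1 / 4) ^ (ℓ + Nat.log 2 q)
      ≤ 2 ^ (ℓ + Nat.log 2 q) * ENNReal.ofReal (1 / 4) ^ (ℓ + Nat.log 2 q) :=
        mul_le_mul_left (by exact_mod_cast hlt) _
    _ = (2 : ℝ≥0∞)⁻¹ ^ (ℓ + Nat.log 2 q) := by
        rw [← mul_pow, h4, ← mul_assoc, h2, one_mul]
    _ ≤ _ := by
        refine pow_le_pow_right_of_le_one' ?_ (by omega)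
        exact ENNReal.inv_le_one.2 (by norm_num)

/-- With the right guess a sample fails with probability at most `1/10`, so it is unlikely that a
quarter of the samples fail. -/
theorem lwe_accepts (hq : 2 ≤ q) {ev : Rq K q →+* ZMod q} {σ : ℝ} (hσ : 0 < σ)
    (h : (discreteGaussian K σ hσ).toOuterMeasure {e | ¬ IsSmall (ev (Ideal.Quotient.mk _ e))} ≤
      ENNReal.ofReal (1 / 10)) (s : Rq K q) {ℓ m : ℕ} (hℓ : 1 ≤ ℓ)
    (hm : m = 32 * (ℓ + Nat.log 2 q)) :
    1 - (2 : ℝ≥0∞)⁻¹ ^ ℓ ≤ (iidSamples (lweSample K q σ hσ s) m).toOuterMeasure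
      {d | Accepts fun i => (ev (d i).1, ev (d i).2)} := by
  set g : ZMod q := -ev s with hg
  have h1 := lweSample_not_isSmall hσ h s hg
  have h2 := iidSamples_count_le (c := 1 / 4) (m := m) (k := 8 * (ℓ + Nat.log 2 q)) (w := 2)
    (M := ℓ + Nat.log 2 q) h1 (by norm_num) (by
      rw [hm, pow_mul, pow_mul, ← mul_pow]
      exact pow_le_pow_left₀ (by norm_num) (by norm_num) _) (by norm_num)
  refine le_trans ?_ (one_sub_le_of_compl_subset _
    (B := {d | 8 * (ℓ + Nat.log 2 q) ≤ Finset.card {i |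
      ¬ IsSmall (ev (d i).2 + g * ev (d i).1)}}) ?_)
  · refine tsub_le_tsub_left (h2.trans ?_) 1
    refine le_trans ?_ (four_pow_bound ℓ q hℓ)
    refine le_mul_of_one_le_left zero_le ?_
    exact_mod_cast (by omega : 1 ≤ q)
  · intro d hd
    by_contra hlt
    refine hd ⟨g.val, ZMod.val_lt g, ?_⟩
    rw [Set.mem_ofPred_eq, not_le] at hlt
    have h3 := Finset.card_filter_add_card_filter_not (s := (Finset.univ : Finset (Fin m)))
      (fun i => IsSmall (ev (d i).2 + g * ev (d i).1))
    rw [Finset.card_univ, Fintype.card_fin] at h3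
    simp only [ZMod.natCast_zmod_val]
    omega

/-- For each of the `q` guesses a uniform sample passes with probability at most `3/5`, so it is
unlikely that three quarters of the samples pass; the summand `log₂ q` in the number of samples pays
for the union bound. -/
theorem uniform_not_accepts (hq : 2 ≤ q) (ev : Rq K q →+* ZMod q) {ℓ m : ℕ} (hℓ : 1 ≤ ℓ)
    (hm : m = 32 * (ℓ + Nat.log 2 q)) :
    1 - (2 : ℝ≥0∞)⁻¹ ^ ℓ ≤ (iidSamples (uniformSample K q) m).toOuterMeasure
      {d | ¬ Accepts fun i => (ev (d i).1, ev (d i).2)} := by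
  let B : ℕ → Set (Fin m → Rq K q × Rq K q) := fun g =>
    {d | 24 * (ℓ + Nat.log 2 q) ≤ Finset.card {i |
      IsSmall (ev (d i).2 + (g : ZMod q) * ev (d i).1)}}
  have hc : (1 + ((1 : ℕ) : ℝ) * (3 / 5)) ^ m ≤
      (1 / 4) ^ (ℓ + Nat.log 2 q) * (((1 : ℕ) : ℝ) + 1) ^ (24 * (ℓ + Nat.log 2 q)) := by
    rw [hm, pow_mul, pow_mul, ← mul_pow]
    exact pow_le_pow_left₀ (by norm_num) (by norm_num) _
  have h2 : ∀ g : ℕ, (iidSamples (uniformSample K q) m).toOuterMeasure (B g) ≤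
      ENNReal.ofReal (1 / 4) ^ (ℓ + Nat.log 2 q) := by
    intro g
    have h := iidSamples_count_le (uniformSample_isSmall hq ev (g : ZMod q)) (by norm_num) hc
      (by norm_num)
    exact h
  have h3 : (iidSamples (uniformSample K q) m).toOuterMeasure (⋃ g ∈ Finset.range q, B g) ≤
      (2 : ℝ≥0∞)⁻¹ ^ ℓ := by
    refine (MeasureTheory.measure_biUnion_finset_le
      (μ := (iidSamples (uniformSample K q) m).toOuterMeasure) _ _).trans ?_
    refine (Finset.sum_le_sum fun g _ => h2 g).trans ?_
    rw [Finset.sum_const, Finset.card_range, nsmul_eq_mul]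
    exact four_pow_bound ℓ q hℓ
  refine (tsub_le_tsub_left h3 1).trans (one_sub_le_of_compl_subset _ ?_)
  · intro d hd
    have hd' : Accepts fun i => (ev (d i).1, ev (d i).2) := by
      by_contra h
      exact hd h
    obtain ⟨g, hg, hc⟩ := hd'
    simp only [Set.mem_iUnion]
    refine ⟨g, Finset.mem_range.2 hg, ?_⟩
    change 24 * (ℓ + Nat.log 2 q) ≤ _
    simp only at hc
    omega

end Evaluation

/-! ### Cost bounds for the random access machine -/

namespace RAM

/-- The number of nodes of an expression. -/
def Expr.nodes : Expr → ℕ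
  | const _ => 1
  | load a => a.nodes + 1
  | add a b => a.nodes + b.nodes + 1
  | sub a b => a.nodes + b.nodes + 1
  | mul a b => a.nodes + b.nodes + 1
  | div a b => a.nodes + b.nodes + 1
  | mod a b => a.nodes + b.nodes + 1

/-- All values that occur in the evaluation of an expression are at most `V`. -/
def Expr.Within (s : Mem) (V : ℕ) : Expr → Prop
  | const c => c ≤ V
  | load a => a.Within s V ∧ s (a.eval s) ≤ V
  | add a b => a.Within s V ∧ b.Within s V ∧ a.eval s + b.eval s ≤ V
  | sub a b => a.Within s V ∧ b.Within s V
  | mul a b => a.Within s V ∧ b.Within s V ∧ a.eval s * b.eval s ≤ V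
  | div a b => a.Within s V ∧ b.Within s V
  | mod a b => a.Within s V ∧ b.Within s V

theorem Expr.Within.eval_le {s : Mem} {V : ℕ} {e : Expr} (h : e.Within s V) : e.eval s ≤ V := by
  induction e with
  | const c => exact h
  | load a _ => exact h.2
  | add a b _ _ => exact h.2.2
  | sub a b iha _ => exact (Nat.sub_le _ _).trans (iha h.1)
  | mul a b _ _ => exact h.2.2
  | div a b iha _ => exact (Nat.div_le_self _ _).trans (iha h.1)
  | mod a b iha _ => exact (Nat.mod_le _ _).trans (iha h.1)

theorem Expr.Within.cost_le {s : Mem} {V : ℕ} {e : Expr} (h : e.Within s V) :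
    e.cost s ≤ e.nodes * (1 + V.size) ^ 2 := by
  have key : ∀ x y, x ≤ V → y ≤ V → 1 + x.size + y.size ≤ (1 + V.size) ^ 2 := by
    intro x y hx hy
    have h1 := Nat.size_le_size hx
    have h2 := Nat.size_le_size hy
    nlinarith [Nat.zero_le (V.size ^ 2)]
  have key2 : ∀ x y, x ≤ V → y ≤ V → (1 + x.size) * (1 + y.size) ≤ (1 + V.size) ^ 2 := by
    intro x y hx hy
    rw [sq]
    exact Nat.mul_le_mul (Nat.add_le_add_left (Nat.size_le_size hx) 1)
      (Nat.add_le_add_left (Nat.size_le_size hy) 1)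
  induction e with
  | const c =>
    have := key c 0 h (Nat.zero_le _)
    rw [Nat.size_zero] at this
    simpa [cost, nodes] using this
  | load a iha =>
    have h1 := iha h.1
    have h2 := key _ _ h.1.eval_le h.2
    simp only [cost, nodes, add_mul, one_mul]
    omega
  | add a b iha ihb =>
    have h1 := iha h.1
    have h3 := ihb h.2.1
    have h2 := key _ _ h.1.eval_le h.2.1.eval_le
    simp only [cost, nodes, add_mul, one_mul]
    omega
  | sub a b iha ihb =>
    have h1 := iha h.1
    have h3 := ihb h.2
    have h2 := key _ _ h.1.eval_le h.2.eval_le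
    simp only [cost, nodes, add_mul, one_mul]
    omega
  | mul a b iha ihb =>
    have h1 := iha h.1
    have h3 := ihb h.2.1
    have h2 := key2 _ _ h.1.eval_le h.2.1.eval_le
    simp only [cost, nodes, add_mul (_ + _), add_mul a.nodes, one_mul]
    omega
  | div a b iha ihb =>
    have h1 := iha h.1
    have h3 := ihb h.2
    have h2 := key2 _ _ h.1.eval_le h.2.eval_le
    simp only [cost, nodes, add_mul (_ + _), add_mul a.nodes, one_mul]
    omega
  | mod a b iha ihb =>
    have h1 := iha h.1
    have h3 := ihb h.2
    have h2 := key2 _ _ h.1.eval_le h.2.eval_le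
    simp only [cost, nodes, add_mul (_ + _), add_mul a.nodes, one_mul]
    omega

/-- The program `c` halts from memory `s` in a memory with property `Q`, after at most `k` steps of
cost `(1 + size V)²` each. -/
def Runs (V : ℕ) (c : Prog) (s : Mem) (k : ℕ) (Q : Mem → Prop) : Prop :=
  ∃ t s', Exec c s t s' ∧ t ≤ k * (1 + V.size) ^ 2 ∧ Q s'

variable {V k l N : ℕ} {s : Mem} {c d : Prog} {e a : Expr} {P Q : Mem → Prop}

theorem Runs.mono (h : Runs V c s k Q) (hkl : k ≤ l) : Runs V c s l Q := by
  obtain ⟨t, s', h1, h2, h3⟩ := h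
  exact ⟨t, s', h1, h2.trans (Nat.mul_le_mul_right _ hkl), h3⟩

theorem Runs.skip (h : Q s) : Runs V Prog.skip s 1 Q :=
  ⟨1, s, Exec.skip s, by rw [one_mul]; exact Nat.one_le_pow _ _ (by omega), h⟩

theorem Runs.seq (h1 : Runs V c s k P) (h2 : ∀ s', P s' → Runs V d s' l Q) :
    Runs V (Prog.seq c d) s (k + l) Q := by
  obtain ⟨t, s', h3, h4, h5⟩ := h1
  obtain ⟨t', s'', h6, h7, h8⟩ := h2 s' h5
  exact ⟨t + t', s'', Exec.seq h3 h6, by rw [add_mul]; omega, h8⟩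

theorem Runs.store {x y : ℕ} (ha : a.Within s V) (he : e.Within s V) (hx : a.eval s = x)
    (hy : e.eval s = y) (h : Q (Function.update s x y)) :
    Runs V (Prog.store a e) s (a.nodes + e.nodes + 1) Q := by
  subst hx hy
  refine ⟨_, _, Exec.store a e s, ?_, h⟩
  have h1 := ha.cost_le
  have h2 := he.cost_le
  have h3 := Nat.size_le_size ha.eval_le
  have h4 := Nat.size_le_size he.eval_le
  have h5 : 1 + V.size + V.size ≤ (1 + V.size) ^ 2 := by nlinarith [Nat.zero_le (V.size ^ 2)]
  rw [add_mul, add_mul, one_mul]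
  omega

theorem Runs.store_seq {x y : ℕ} (ha : a.Within s V) (he : e.Within s V) (hx : a.eval s = x)
    (hy : e.eval s = y) (h : Runs V d (Function.update s x y) l Q) :
    Runs V (Prog.seq (Prog.store a e) d) s (a.nodes + e.nodes + 1 + l) Q :=
  (Runs.store (Q := fun s' => s' = Function.update s x y) ha he hx hy rfl).seq
    fun _ hs => hs ▸ h

theorem Runs.ite (he : e.Within s V) (h1 : e.eval s ≠ 0 → Runs V c s k Q)
    (h2 : e.eval s = 0 → Runs V d s k Q) : Runs V (Prog.ite e c d) s (e.nodes + 1 + k) Q := by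
  have hc := he.cost_le
  have h1' : 1 ≤ (1 + V.size) ^ 2 := Nat.one_le_pow _ _ (by omega)
  by_cases h : e.eval s = 0
  · obtain ⟨t, s', h3, h4, h5⟩ := h2 h
    exact ⟨_, s', Exec.ite_false h h3, by rw [add_mul, add_mul, one_mul]; omega, h5⟩
  · obtain ⟨t, s', h3, h4, h5⟩ := h1 h
    exact ⟨_, s', Exec.ite_true h h3, by rw [add_mul, add_mul, one_mul]; omega, h5⟩

/-- A loop whose condition becomes zero after exactly `N` rounds. -/
theorem Runs.loop {Inv : ℕ → Mem → Prop} (hw : ∀ i ≤ N, ∀ s, Inv i s → e.Within s V)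
    (ht : ∀ i < N, ∀ s, Inv i s → e.eval s ≠ 0) (hf : ∀ s, Inv N s → e.eval s = 0)
    (hb : ∀ i < N, ∀ s, Inv i s → Runs V c s k (Inv (i + 1))) (h0 : Inv 0 s) :
    Runs V (Prog.while e c) s (N * (e.nodes + 1 + k) + (e.nodes + 1)) (Inv N) := by
  have h1' : 1 ≤ (1 + V.size) ^ 2 := Nat.one_le_pow _ _ (by omega)
  suffices h : ∀ r i s, i + r = N → Inv i s →
      Runs V (Prog.while e c) s (r * (e.nodes + 1 + k) + (e.nodes + 1)) (Inv N) from
    h N 0 s (zero_add N) h0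
  intro r
  induction r with
  | zero =>
    intro i s hi hs
    obtain rfl : i = N := hi
    have hc := (hw i le_rfl s hs).cost_le
    exact ⟨_, s, Exec.while_false (hf s hs),
      by rw [zero_mul, zero_add, add_mul, one_mul]; omega, hs⟩
  | succ r ih =>
    intro i s hi hs
    have hc := (hw i (by omega) s hs).cost_le
    obtain ⟨t, s', h3, h4, h5⟩ := hb i (by omega) s hs
    obtain ⟨t', s'', h6, h7, h8⟩ := ih (i + 1) s' (by omega) h5
    refine ⟨_, s'', Exec.while_true (ht i (by omega) s hs) h3 h6, ?_, h8⟩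
    have h9 : ((r + 1) * (e.nodes + 1 + k) + (e.nodes + 1)) * (1 + V.size) ^ 2 =
        e.nodes * (1 + V.size) ^ 2 + (1 + V.size) ^ 2 + k * (1 + V.size) ^ 2 +
        (r * (e.nodes + 1 + k) + (e.nodes + 1)) * (1 + V.size) ^ 2 := by ring
    omega

end RAM

/-! ### The program -/

namespace RAM

open RAM.Expr RAM.Prog

/-- The content of the memory cell with a fixed address. -/
def Expr.cell (x : ℕ) : Expr := load (const x)

/-- One step of the summation of the coefficients of `a_i` and `b_i`: cells `2` and `4` hold the
indices `i` and `j`, cells `6` and `8` the partial sums. -/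
def sumStep : Prog :=
  seq (store (const 6) (add (cell 6) (load (add (add (const 7)
    (mul (const 4) (mul (cell 1) (cell 2)))) (mul (const 2) (cell 4))))))
  (seq (store (const 8) (add (cell 8) (load (add (add (add (const 7)
    (mul (const 4) (mul (cell 1) (cell 2)))) (mul (const 2) (cell 1))) (mul (const 2) (cell 4))))))
  (store (const 4) (add (cell 4) (const 1))))

/-- Computes `a_i(1)` and `b_i(1)` and stores them in the cells `14 + 4 i` and `16 + 4 i`. -/
def evalStep : Prog :=
  seq (store (const 6) (const 0))
  (seq (store (const 8) (const 0))
  (seq (store (const 4) (const 0))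
  (seq (Prog.while (sub (cell 1) (cell 4)) sumStep)
  (seq (store (add (const 14) (mul (const 4) (cell 2))) (cell 6))
  (seq (store (add (const 16) (mul (const 4) (cell 2))) (cell 8))
  (store (const 2) (add (cell 2) (const 1))))))))

/-- Increases the counter in cell `12` if `b_i(1) + g a_i(1)` is small modulo `q`, where cell `10`
holds `g`. -/
def countStep : Prog :=
  seq (store (const 6) (mod (add (load (add (const 16) (mul (const 4) (cell 2))))
    (mul (cell 10) (load (add (const 14) (mul (const 4) (cell 2)))))) (cell 3)))
  (seq (ite (add (sub (cell 3) (mul (const 4) (cell 6)))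
      (sub (cell 3) (mul (const 4) (sub (cell 3) (cell 6)))))
    (store (const 12) (add (cell 12) (const 1))) skip)
  (store (const 2) (add (cell 2) (const 1))))

/-- Tests one guess `g` and sets the answer to `1` if more than three quarters of the samples
pass. -/
def guessStep : Prog :=
  seq (store (const 2) (const 0))
  (seq (store (const 12) (const 0))
  (seq (Prog.while (sub (cell 5) (cell 2)) countStep)
  (seq (ite (sub (mul (const 4) (cell 12)) (mul (const 3) (cell 5)))
    (store (const 0) (const 1)) skip)
  (store (const 10) (add (cell 10) (const 1))))))

/-- The distinguisher. -/
def attack : Prog :=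
  seq (Prog.while (sub (cell 5) (cell 2)) evalStep)
  (Prog.while (sub (cell 3) (cell 10)) guessStep)

/-- The value `a_i(1)` computed from the initial memory (as a sum of representatives). -/
def sumA (s₀ : Mem) (n i : ℕ) : ℕ := ∑ j ∈ Finset.range n, s₀ (7 + 4 * (n * i) + 2 * j)

/-- The value `b_i(1)` computed from the initial memory (as a sum of representatives). -/
def sumB (s₀ : Mem) (n i : ℕ) : ℕ := ∑ j ∈ Finset.range n, s₀ (7 + 4 * (n * i) + 2 * n + 2 * j)

/-- The `i`-th sample passes the test for the guess `g`. -/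
def Passes (s₀ : Mem) (n q g i : ℕ) : Prop :=
  4 * ((sumB s₀ n i + g * sumA s₀ n i) % q) < q ∨
    4 * (q - (sumB s₀ n i + g * sumA s₀ n i) % q) < q

instance (s₀ : Mem) (n q g : ℕ) : DecidablePred (Passes s₀ n q g) := fun _ =>
  inferInstanceAs (Decidable (_ ∨ _))

/-- The memory holds the input, the sums that were computed from it, and the registers `i`, `g` and
the answer; the remaining registers are left open. -/
structure State (s₀ : Mem) (n ia i g ans : ℕ) (s : Mem) : Prop where
  odd : ∀ x, s (2 * x + 1) = s₀ (2 * x + 1)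
  sums : ∀ i' < ia, s (14 + 4 * i') = sumA s₀ n i' ∧ s (16 + 4 * i') = sumB s₀ n i'
  idx : s 2 = i
  guess : s 10 = g
  answer : s 0 = ans

/-- What is needed of the input and of the bound `V` for the values in memory. -/
structure Input (s₀ : Mem) (n q m V : ℕ) : Prop where
  cell_n : s₀ 1 = n
  cell_q : s₀ 3 = q
  cell_m : s₀ 5 = m
  even : ∀ x, s₀ (2 * x) = 0
  coeff : ∀ i < m, ∀ j < n, s₀ (7 + 4 * (n * i) + 2 * j) ≤ q ∧
    s₀ (7 + 4 * (n * i) + 2 * n + 2 * j) ≤ q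
  address_le : 40 + 4 * (n * m) + 4 * n + 4 * m ≤ V
  value_le : n * q + q * (n * q) + 8 * q ≤ V

/-- Writing to an even cell outside the sums. -/
theorem State.update_temp {s₀ s : Mem} {n ia i g ans x y : ℕ} (h : State s₀ n ia i g ans s)
    (hx : x = 4 ∨ x = 6 ∨ x = 8 ∨ x = 12) : State s₀ n ia i g ans (Function.update s x y) where
  odd := fun z => by rw [Function.update_of_ne (by omega)]; exact h.odd z
  sums := fun z hz => by
    rw [Function.update_of_ne (by omega), Function.update_of_ne (by omega)]; exact h.sums z hz
  idx := by rw [Function.update_of_ne (by omega)]; exact h.idx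
  guess := by rw [Function.update_of_ne (by omega)]; exact h.guess
  answer := by rw [Function.update_of_ne (by omega)]; exact h.answer

theorem State.update_idx {s₀ s : Mem} {n ia i g ans y : ℕ} (h : State s₀ n ia i g ans s) :
    State s₀ n ia y g ans (Function.update s 2 y) where
  odd := fun z => by rw [Function.update_of_ne (by omega)]; exact h.odd z
  sums := fun z hz => by
    rw [Function.update_of_ne (by omega), Function.update_of_ne (by omega)]; exact h.sums z hz
  idx := Function.update_self _ _ _
  guess := by rw [Function.update_of_ne (by omega)]; exact h.guess
  answer := by rw [Function.update_of_ne (by omega)]; exact h.answer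

theorem State.update_guess {s₀ s : Mem} {n ia i g ans y : ℕ} (h : State s₀ n ia i g ans s) :
    State s₀ n ia i y ans (Function.update s 10 y) where
  odd := fun z => by rw [Function.update_of_ne (by omega)]; exact h.odd z
  sums := fun z hz => by
    rw [Function.update_of_ne (by omega), Function.update_of_ne (by omega)]; exact h.sums z hz
  idx := by rw [Function.update_of_ne (by omega)]; exact h.idx
  guess := Function.update_self _ _ _
  answer := by rw [Function.update_of_ne (by omega)]; exact h.answer

theorem State.update_answer {s₀ s : Mem} {n ia i g ans y : ℕ} (h : State s₀ n ia i g ans s) :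
    State s₀ n ia i g y (Function.update s 0 y) where
  odd := fun z => by rw [Function.update_of_ne (by omega)]; exact h.odd z
  sums := fun z hz => by
    rw [Function.update_of_ne (by omega), Function.update_of_ne (by omega)]; exact h.sums z hz
  idx := by rw [Function.update_of_ne (by omega)]; exact h.idx
  guess := by rw [Function.update_of_ne (by omega)]; exact h.guess
  answer := Function.update_self _ _ _

theorem State.update_sums {s₀ s : Mem} {n ia i g ans : ℕ} (h : State s₀ n ia i g ans s) :
    State s₀ n (ia + 1) i g ans (Function.update (Function.update s (14 + 4 * ia) (sumA s₀ n ia))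
      (16 + 4 * ia) (sumB s₀ n ia)) where
  odd := fun z => by
    rw [Function.update_of_ne (by omega), Function.update_of_ne (by omega)]; exact h.odd z
  sums := fun z hz => by
    rcases Nat.lt_succ_iff_lt_or_eq.1 hz with h1 | rfl
    · rw [Function.update_of_ne (by omega), Function.update_of_ne (by omega),
        Function.update_of_ne (by omega), Function.update_of_ne (by omega)]
      exact h.sums z h1
    · rw [Function.update_of_ne (by omega), Function.update_self, Function.update_self]
      exact ⟨rfl, rfl⟩
  idx := by rw [Function.update_of_ne (by omega), Function.update_of_ne (by omega)]; exact h.idx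
  guess := by
    rw [Function.update_of_ne (by omega), Function.update_of_ne (by omega)]; exact h.guess
  answer := by
    rw [Function.update_of_ne (by omega), Function.update_of_ne (by omega)]; exact h.answer

section

variable {s₀ s : Mem} {n q m V ia i g ans j : ℕ}

theorem Input.one (h : Input s₀ n q m V) (hs : State s₀ n ia i g ans s) : s 1 = n :=
  (hs.odd 0).trans h.cell_n

theorem Input.three (h : Input s₀ n q m V) (hs : State s₀ n ia i g ans s) : s 3 = q :=
  (hs.odd 1).trans h.cell_q

theorem Input.five (h : Input s₀ n q m V) (hs : State s₀ n ia i g ans s) : s 5 = m :=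
  (hs.odd 2).trans h.cell_m

theorem Input.partial_sum_le (h : Input s₀ n q m V) (hi : i < m) (hj : j ≤ n) :
    ∑ j' ∈ Finset.range j, s₀ (7 + 4 * (n * i) + 2 * j') ≤ n * q ∧
    ∑ j' ∈ Finset.range j, s₀ (7 + 4 * (n * i) + 2 * n + 2 * j') ≤ n * q := by
  have hjq : j * q ≤ n * q := Nat.mul_le_mul_right q hj
  constructor
  · refine (Finset.sum_le_card_nsmul _ _ q fun x hx => ?_).trans (by simpa using hjq)
    exact (h.coeff i hi x ((Finset.mem_range.1 hx).trans_le hj)).1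
  · refine (Finset.sum_le_card_nsmul _ _ q fun x hx => ?_).trans (by simpa using hjq)
    exact (h.coeff i hi x ((Finset.mem_range.1 hx).trans_le hj)).2

/-- The invariant of the summation loop. -/
structure Summing (s₀ : Mem) (n i j : ℕ) (s : Mem) : Prop where
  state : State s₀ n i i 0 0 s
  idx : s 4 = j
  accA : s 6 = ∑ j' ∈ Finset.range j, s₀ (7 + 4 * (n * i) + 2 * j')
  accB : s 8 = ∑ j' ∈ Finset.range j, s₀ (7 + 4 * (n * i) + 2 * n + 2 * j')

theorem runs_sumStep (h : Input s₀ n q m V) (hi : i < m) (hj : j < n)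
    (hs : Summing s₀ n i j s) : Runs V sumStep s 52 (Summing s₀ n i (j + 1)) := by
  have h1 := h.one hs.state
  have h2 := hs.state.idx
  have h4 := hs.idx
  have hnm : n * i ≤ n * m := Nat.mul_le_mul_left n hi.le
  have hV := h.address_le
  have hV' := h.value_le
  have hco := h.coeff i hi j hj
  have hp := h.partial_sum_le hi hj.le
  have hp' := h.partial_sum_le hi (j := j + 1) hj
  have hA : s (7 + 4 * (n * i) + 2 * j) = s₀ (7 + 4 * (n * i) + 2 * j) := by
    have := hs.state.odd (3 + 2 * (n * i) + j)
    rwa [show 2 * (3 + 2 * (n * i) + j) + 1 = 7 + 4 * (n * i) + 2 * j by ring] at this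
  have hB : s (7 + 4 * (n * i) + 2 * n + 2 * j) = s₀ (7 + 4 * (n * i) + 2 * n + 2 * j) := by
    have := hs.state.odd (3 + 2 * (n * i) + n + j)
    rwa [show 2 * (3 + 2 * (n * i) + n + j) + 1 = 7 + 4 * (n * i) + 2 * n + 2 * j by ring] at this
  rw [Finset.sum_range_succ, Finset.sum_range_succ, ← hs.accA, ← hs.accB] at hp'
  rw [← hs.accA, ← hs.accB] at hp
  refine (Runs.store_seq (x := 6) (y := s 6 + s₀ (7 + 4 * (n * i) + 2 * j)) (l := 31) ?_ ?_ rfl ?_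
    ?_).mono (by decide)
  · simp only [Within]; omega
  · simp only [Within, cell, Expr.eval, h1, h2, h4, hA]; omega
  · simp only [cell, Expr.eval, h1, h2, h4, hA]
  have t1 := hs.state.update_temp (x := 6) (y := s 6 + s₀ (7 + 4 * (n * i) + 2 * j)) (by omega)
  set s1 := Function.update s 6 (s 6 + s₀ (7 + 4 * (n * i) + 2 * j)) with hs1
  have h14 : s1 4 = j := by rw [hs1, Function.update_of_ne (by omega), h4]
  have h18 : s1 8 = s 8 := by rw [hs1, Function.update_of_ne (by omega)]
  have h1B : s1 (7 + 4 * (n * i) + 2 * n + 2 * j) = s₀ (7 + 4 * (n * i) + 2 * n + 2 * j) := by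
    rw [hs1, Function.update_of_ne (by omega), hB]
  have h11 := h.one t1
  have h12 := t1.idx
  refine (Runs.store_seq (x := 8) (y := s 8 + s₀ (7 + 4 * (n * i) + 2 * n + 2 * j)) (l := 6) ?_ ?_
    rfl ?_ ?_).mono (by decide)
  · simp only [Within]; omega
  · simp only [Within, cell, Expr.eval, h11, h12, h14, h18, h1B]; omega
  · simp only [cell, Expr.eval, h11, h12, h14, h18, h1B]
  have t2 := t1.update_temp (x := 8) (y := s 8 + s₀ (7 + 4 * (n * i) + 2 * n + 2 * j)) (by omega)
  set s2 := Function.update s1 8 (s 8 + s₀ (7 + 4 * (n * i) + 2 * n + 2 * j)) with hs2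
  have h24 : s2 4 = j := by rw [hs2, Function.update_of_ne (by omega), h14]
  refine (Runs.store (x := 4) (y := j + 1) ?_ ?_ rfl ?_ ?_).mono (by decide)
  · simp only [Within]; omega
  · simp only [Within, cell, Expr.eval, h24]; omega
  · simp only [cell, Expr.eval, h24]
  · refine ⟨t2.update_temp (by omega), Function.update_self _ _ _, ?_, ?_⟩
    · rw [Function.update_of_ne (by omega), hs2, Function.update_of_ne (by omega), hs1,
        Function.update_self, Finset.sum_range_succ, hs.accA]
    · rw [Function.update_of_ne (by omega), hs2, Function.update_self, Finset.sum_range_succ,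
        hs.accB]

theorem runs_evalStep (h : Input s₀ n q m V) (hi : i < m) (hs : State s₀ n i i 0 0 s) :
    Runs V evalStep s (60 * n + 60) (State s₀ n (i + 1) (i + 1) 0 0) := by
  have hV := h.address_le
  have hV' := h.value_le
  refine (Runs.store_seq (x := 6) (y := 0) (l := 60 * n + 57) ?_ ?_ rfl rfl ?_).mono
    (by simp only [nodes]; omega)
  · simp only [Within]; omega
  · simp only [Within]; omega
  refine (Runs.store_seq (x := 8) (y := 0) (l := 60 * n + 54) ?_ ?_ rfl rfl ?_).mono
    (by simp only [nodes]; omega)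
  · simp only [Within]; omega
  · simp only [Within]; omega
  refine (Runs.store_seq (x := 4) (y := 0) (l := 60 * n + 51) ?_ ?_ rfl rfl ?_).mono
    (by simp only [nodes]; omega)
  · simp only [Within]; omega
  · simp only [Within]; omega
  refine (Runs.seq (k := 60 * n + 10) (l := 41) (P := Summing s₀ n i n) ?_ fun s' hs' => ?_).mono
    (by omega)
  · refine (Runs.loop (N := n) (k := 52) (Inv := Summing s₀ n i) ?_ ?_ ?_
      (fun j hj s hs => runs_sumStep h hi hj hs) ?_).mono (by simp only [nodes, cell]; omega)
    · intro j hj s hs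
      simp only [Within, cell, Expr.eval, h.one hs.state, hs.idx]
      omega
    · intro j hj s hs
      simp only [cell, Expr.eval, h.one hs.state, hs.idx]
      omega
    · intro s hs
      simp only [cell, Expr.eval, h.one hs.state, hs.idx]
      omega
    · refine ⟨((hs.update_temp (by omega)).update_temp (by omega)).update_temp (by omega),
        Function.update_self _ _ _, ?_, ?_⟩
      · rw [Function.update_of_ne (by omega), Function.update_of_ne (by omega),
          Function.update_self]
        rfl
      · rw [Function.update_of_ne (by omega), Function.update_self]
        rfl
  · have h2 := hs'.state.idx
    have h6 : s' 6 = sumA s₀ n i := hs'.accA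
    have h8 : s' 8 = sumB s₀ n i := hs'.accB
    have hp := h.partial_sum_le hi (le_refl n)
    rw [← hs'.accA, ← hs'.accB, h6, h8] at hp
    refine (Runs.store_seq (x := 14 + 4 * i) (y := sumA s₀ n i) (l := 27) ?_ ?_ ?_
      (by simp only [cell, Expr.eval, h6]) ?_).mono
      (by decide)
    · simp only [Within, cell, Expr.eval, h2]; omega
    · simp only [Within, cell, Expr.eval, h6]; omega
    · simp only [cell, Expr.eval, h2]
    set s1 := Function.update s' (14 + 4 * i) (sumA s₀ n i) with hs1
    have h12 : s1 2 = i := by rw [hs1, Function.update_of_ne (by omega), h2]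
    have h18 : s1 8 = sumB s₀ n i := by rw [hs1, Function.update_of_ne (by omega), h8]
    refine (Runs.store_seq (x := 16 + 4 * i) (y := sumB s₀ n i) (l := 10) ?_ ?_ ?_
      (by simp only [cell, Expr.eval, h18]) ?_).mono
      (by decide)
    · simp only [Within, cell, Expr.eval, h12]; omega
    · simp only [Within, cell, Expr.eval, h18]; omega
    · simp only [cell, Expr.eval, h12]
    have t2 : State s₀ n (i + 1) i 0 0 (Function.update s1 (16 + 4 * i) (sumB s₀ n i)) :=
      hs'.state.update_sums
    set s2 := Function.update s1 (16 + 4 * i) (sumB s₀ n i) with hs2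
    have h22 := t2.idx
    refine (Runs.store (x := 2) (y := i + 1) ?_ ?_ rfl ?_ t2.update_idx).mono (by decide)
    · simp only [Within]; omega
    · simp only [Within, cell, Expr.eval, h22]; omega
    · simp only [cell, Expr.eval, h22]

/-- The invariant of the counting loop. -/
structure Counting (s₀ : Mem) (n q m g ans i : ℕ) (s : Mem) : Prop where
  state : State s₀ n m i g ans s
  count : s 12 = Nat.count (Passes s₀ n q g) i

theorem runs_countStep (h : Input s₀ n q m V) (hg : g < q) (hi : i < m)
    (hs : Counting s₀ n q m g ans i s) :
    Runs V countStep s 60 (Counting s₀ n q m g ans (i + 1)) := by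
  have hV := h.address_le
  have hV' := h.value_le
  have h2 := hs.state.idx
  have h3 := h.three hs.state
  have h10 := hs.state.guess
  obtain ⟨hA, hB⟩ := hs.state.sums i hi
  have hp := h.partial_sum_le hi (le_refl n)
  have hp1 : sumA s₀ n i ≤ n * q := hp.1
  have hp2 : sumB s₀ n i ≤ n * q := hp.2
  have hmul : g * sumA s₀ n i ≤ q * (n * q) := Nat.mul_le_mul hg.le hp1
  have hlt : (sumB s₀ n i + g * sumA s₀ n i) % q < q := Nat.mod_lt _ (by omega)
  have hcount : Nat.count (Passes s₀ n q g) i ≤ i := Nat.count_le _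
  set v := (sumB s₀ n i + g * sumA s₀ n i) % q with hv
  refine (Runs.store_seq (x := 6) (y := v) (l := 37) ?_ ?_ rfl ?_ ?_).mono (by decide)
  · simp only [Within]; omega
  · simp only [Within, cell, Expr.eval, h2, h3, h10, hA, hB]; omega
  · simp only [cell, Expr.eval, h2, h3, h10, hA, hB, hv]
  have t1 := hs.state.update_temp (x := 6) (y := v) (by omega)
  set s1 := Function.update s 6 v with hs1
  have h13 := h.three t1
  have h16 : s1 6 = v := Function.update_self _ _ _
  have h1c : s1 12 = Nat.count (Passes s₀ n q g) i := by
    rw [hs1, Function.update_of_ne (by omega), hs.count]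
  refine (Runs.seq (k := 28) (l := 9) (P := fun s' => State s₀ n m i g ans s' ∧
    s' 12 = Nat.count (Passes s₀ n q g) (i + 1)) ?_ ?_).mono (by omega)
  · have hval : (add (sub (cell 3) (mul (const 4) (cell 6)))
        (sub (cell 3) (mul (const 4) (sub (cell 3) (cell 6))))).eval s1 =
        q - 4 * v + (q - 4 * (q - v)) := by
      simp only [cell, Expr.eval, h13, h16]
    refine (Runs.ite (k := 7) ?_ (fun hne => ?_) fun he => ?_).mono (by decide)
    · simp only [Within, cell, Expr.eval, h13, h16]; omega
    · rw [hval] at hne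
      have hpass : Passes s₀ n q g i := by
        unfold Passes
        omega
      refine (Runs.store (x := 12) (y := Nat.count (Passes s₀ n q g) i + 1) ?_ ?_ rfl ?_ ?_).mono
        (by decide)
      · simp only [Within]; omega
      · simp only [Within, cell, Expr.eval, h1c]; omega
      · simp only [cell, Expr.eval, h1c]
      · refine ⟨t1.update_temp (by omega), ?_⟩
        rw [Function.update_self, Nat.count_succ, if_pos hpass]
    · rw [hval] at he
      have hpass : ¬ Passes s₀ n q g i := by
        unfold Passes
        omega
      refine (Runs.skip ?_).mono (by decide)
      exact ⟨t1, by rw [h1c, Nat.count_succ, if_neg hpass, add_zero]⟩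
  · rintro s' ⟨t2, hc⟩
    refine (Runs.store (x := 2) (y := i + 1) ?_ ?_ rfl ?_ ⟨t2.update_idx, ?_⟩).mono (by decide)
    · simp only [Within]; omega
    · simp only [Within, cell, Expr.eval, t2.idx]; omega
    · simp only [cell, Expr.eval, t2.idx]
    · rw [Function.update_of_ne (by omega), hc]

open scoped Classical in
/-- The answer after the guesses below `g`. -/
noncomputable def answerBelow (s₀ : Mem) (n q m g : ℕ) : ℕ :=
  if ∃ g' < g, 3 * m < 4 * Nat.count (Passes s₀ n q g') m then 1 else 0

theorem answerBelow_zero : answerBelow s₀ n q m 0 = 0 := by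
  simp [answerBelow]

theorem answerBelow_succ_of_lt (h : 3 * m < 4 * Nat.count (Passes s₀ n q g) m) :
    answerBelow s₀ n q m (g + 1) = 1 :=
  if_pos ⟨g, Nat.lt_succ_self g, h⟩

theorem answerBelow_succ_of_not_lt (h : ¬ 3 * m < 4 * Nat.count (Passes s₀ n q g) m) :
    answerBelow s₀ n q m (g + 1) = answerBelow s₀ n q m g := by
  unfold answerBelow
  congr 1
  refine propext ⟨?_, ?_⟩
  · rintro ⟨g', h1, h2⟩
    refine ⟨g', lt_of_le_of_ne (Nat.lt_succ_iff.1 h1) ?_, h2⟩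
    rintro rfl
    exact h h2
  · rintro ⟨g', h1, h2⟩
    exact ⟨g', by omega, h2⟩

/-- The invariant of the loop over the guesses. -/
def Guessing (s₀ : Mem) (n q m g : ℕ) (s : Mem) : Prop :=
  ∃ i, State s₀ n m i g (answerBelow s₀ n q m g) s

theorem runs_guessStep (h : Input s₀ n q m V) (hg : g < q) (hs : Guessing s₀ n q m g s) :
    Runs V guessStep s (70 * m + 60) (Guessing s₀ n q m (g + 1)) := by
  have hV := h.address_le
  have hV' := h.value_le
  obtain ⟨i₀, hs⟩ := hs
  refine (Runs.store_seq (x := 2) (y := 0) (l := 70 * m + 57) ?_ ?_ rfl rfl ?_).mono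
    (by simp only [nodes]; omega)
  · simp only [Within]; omega
  · simp only [Within]; omega
  refine (Runs.store_seq (x := 12) (y := 0) (l := 70 * m + 54) ?_ ?_ rfl rfl ?_).mono
    (by simp only [nodes]; omega)
  · simp only [Within]; omega
  · simp only [Within]; omega
  refine (Runs.seq (k := 70 * m + 10) (l := 44)
    (P := Counting s₀ n q m g (answerBelow s₀ n q m g) m) ?_ fun s' hs' => ?_).mono (by omega)
  · refine (Runs.loop (N := m) (k := 60) (Inv := Counting s₀ n q m g (answerBelow s₀ n q m g))
      ?_ ?_ ?_ (fun i hi s hs => runs_countStep h hg hi hs) ?_).mono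
      (by simp only [nodes, cell]; omega)
    · intro i hi s hs
      simp only [Within, cell, Expr.eval, h.five hs.state, hs.state.idx]
      omega
    · intro i hi s hs
      simp only [cell, Expr.eval, h.five hs.state, hs.state.idx]
      omega
    · intro s hs
      simp only [cell, Expr.eval, h.five hs.state, hs.state.idx]
      omega
    · exact ⟨hs.update_idx.update_temp (by omega), Function.update_self _ _ _⟩
  · have h5 := h.five hs'.state
    have hc := hs'.count
    have hcount : Nat.count (Passes s₀ n q g) m ≤ m := Nat.count_le _
    refine (Runs.seq (k := 20) (l := 10)
      (P := State s₀ n m m g (answerBelow s₀ n q m (g + 1))) ?_ fun s2 hs2 => ?_).mono (by omega)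
    · have hval : (sub (mul (const 4) (cell 12)) (mul (const 3) (cell 5))).eval s' =
          4 * Nat.count (Passes s₀ n q g) m - 3 * m := by
        simp only [cell, Expr.eval, h5, hc]
      refine (Runs.ite (k := 3) ?_ (fun hne => ?_) fun he => ?_).mono (by decide)
      · simp only [Within, cell, Expr.eval, h5, hc]; omega
      · rw [hval] at hne
        rw [answerBelow_succ_of_lt (by omega)]
        refine (Runs.store (x := 0) (y := 1) ?_ ?_ rfl rfl hs'.state.update_answer).mono (by decide)
        · simp only [Within]; omega
        · simp only [Within]; omega
      · rw [hval] at he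
        rw [answerBelow_succ_of_not_lt (by omega)]
        exact (Runs.skip hs'.state).mono (by decide)
    · have h10 := hs2.guess
      refine (Runs.store (x := 10) (y := g + 1) ?_ ?_ rfl ?_ ⟨m, hs2.update_guess⟩).mono (by decide)
      · simp only [Within]; omega
      · simp only [Within, cell, Expr.eval, h10]; omega
      · simp only [cell, Expr.eval, h10]

theorem runs_attack (h : Input s₀ n q m V) :
    Runs V attack s₀ (m * (60 * n + 70) + q * (70 * m + 70) + 20)
      (fun s => s 0 = answerBelow s₀ n q m q) := by
  have hV := h.address_le
  have hV' := h.value_le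
  refine (Runs.seq (k := m * (60 * n + 70) + 10) (l := q * (70 * m + 70) + 10)
    (P := State s₀ n m m 0 0) ?_ fun s hs => ?_).mono (by omega)
  · refine (Runs.loop (N := m) (k := 60 * n + 60) (Inv := fun i => State s₀ n i i 0 0) ?_ ?_ ?_
      (fun i hi s hs => runs_evalStep h hi hs) ?_).mono ?_
    · intro i hi s hs
      simp only [Within, cell, Expr.eval, h.five hs, hs.idx]
      omega
    · intro i hi s hs
      simp only [cell, Expr.eval, h.five hs, hs.idx]
      omega
    · intro s hs
      simp only [cell, Expr.eval, h.five hs, hs.idx]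
      omega
    · exact ⟨fun _ => rfl, fun i hi => absurd hi (Nat.not_lt_zero i), h.even 1, h.even 5, h.even 0⟩
    · refine Nat.add_le_add (Nat.mul_le_mul_left m ?_) (by decide)
      simp only [nodes, cell]
      omega
  · obtain ⟨t, s', h1, h2, i, hs'⟩ : Runs V (Prog.while (sub (cell 3) (cell 10)) guessStep) s
        (q * (70 * m + 70) + 10) (Guessing s₀ n q m q) := by
      refine (Runs.loop (N := q) (k := 70 * m + 60) (Inv := Guessing s₀ n q m) ?_ ?_ ?_
        (fun g hg s hs => runs_guessStep h hg hs) ?_).mono ?_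
      · rintro g hg s ⟨i, hs⟩
        simp only [Within, cell, Expr.eval, h.three hs, hs.guess]
        omega
      · rintro g hg s ⟨i, hs⟩
        simp only [cell, Expr.eval, h.three hs, hs.guess]
        omega
      · rintro s ⟨i, hs⟩
        simp only [cell, Expr.eval, h.three hs, hs.guess]
        omega
      · exact ⟨m, by rw [answerBelow_zero]; exact hs⟩
      · refine Nat.add_le_add (Nat.mul_le_mul_left q ?_) (by decide)
        simp only [nodes, cell]
        omega
    exact ⟨t, s', h1, h2, hs'.answer⟩

end

end RAM

/-! ### The program on a dataset -/

section Dataset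

theorem getD_flatten_ofFn {L : ℕ} : ∀ {m : ℕ} (f : Fin m → List ℕ), (∀ i, (f i).length = L) →
    ∀ (i : Fin m) (j : ℕ), j < L → (List.ofFn f).flatten.getD (L * i + j) 0 = (f i).getD j 0
  | 0, _, _, i, _, _ => i.elim0
  | m + 1, f, hf, i, j, hj => by
    rw [List.ofFn_succ, List.flatten_cons]
    refine Fin.cases ?_ (fun i => ?_) i
    · rw [Fin.val_zero, mul_zero, zero_add, List.getD_append _ _ _ _ (by rw [hf]; exact hj)]
    · have h1 : L * ((Fin.succ i : Fin (m + 1)) : ℕ) + j = L + (L * i + j) := by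
        rw [Fin.val_succ]; ring
      rw [h1, List.getD_append_right _ _ _ _ (by rw [hf]; omega), hf, Nat.add_sub_cancel_left]
      exact getD_flatten_ofFn (fun i => f i.succ) (fun i => hf _) i j hj

variable {n q m : ℕ} (d : Fin m → (Fin n → ZMod q) × (Fin n → ZMod q))

theorem initMem_inputWords_coeff (i : Fin m) {j : ℕ} (hj : j < 2 * n) :
    RAM.initMem (inputWords n q m d) (7 + 4 * (n * i) + 2 * j) =
      (List.ofFn (fun j => ((d i).1 j).val) ++ List.ofFn (fun j => ((d i).2 j).val)).getD j 0 := by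
  have h1 : (7 + 4 * (n * i) + 2 * j) % 2 = 1 := by omega
  have h2 : (7 + 4 * (n * i) + 2 * j) / 2 = 3 + (2 * n * i + j) := by
    rw [mul_assoc]; omega
  rw [RAM.initMem, if_pos h1, h2, inputWords,
    List.getD_append_right _ _ _ _ (by simp only [List.length_cons, List.length_nil]; omega)]
  simp only [List.length_cons, List.length_nil, zero_add, Nat.add_sub_cancel_left]
  rw [List.flatMap_def, List.map_ofFn]
  exact getD_flatten_ofFn _ (fun i => by simp; omega) i j hj

theorem initMem_inputWords_fst (i : Fin m) (j : Fin n) :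
    RAM.initMem (inputWords n q m d) (7 + 4 * (n * i) + 2 * j) = ((d i).1 j).val := by
  rw [initMem_inputWords_coeff d i (by omega), List.getD_append _ _ _ _ (by simp),
    List.getD_eq_getElem _ _ (by simp), List.getElem_ofFn]

theorem initMem_inputWords_snd (i : Fin m) (j : Fin n) :
    RAM.initMem (inputWords n q m d) (7 + 4 * (n * i) + 2 * n + 2 * j) = ((d i).2 j).val := by
  rw [show 7 + 4 * (n * (i : ℕ)) + 2 * n + 2 * (j : ℕ) = 7 + 4 * (n * i) + 2 * (n + j) by ring,
    initMem_inputWords_coeff d i (by omega), List.getD_append_right _ _ _ _ (by simp),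
    List.length_ofFn, Nat.add_sub_cancel_left, List.getD_eq_getElem _ _ (by simp),
    List.getElem_ofFn]

theorem input_inputWords [NeZero q] {V : ℕ} (h1 : 40 + 4 * (n * m) + 4 * n + 4 * m ≤ V)
    (h2 : n * q + q * (n * q) + 8 * q ≤ V) :
    RAM.Input (RAM.initMem (inputWords n q m d)) n q m V where
  cell_n := by simp [RAM.initMem, inputWords]
  cell_q := by simp [RAM.initMem, inputWords]
  cell_m := by simp [RAM.initMem, inputWords]
  even := fun x => by simp [RAM.initMem]
  coeff := fun i hi j hj => by
    have h3 := initMem_inputWords_fst d ⟨i, hi⟩ ⟨j, hj⟩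
    have h4 := initMem_inputWords_snd d ⟨i, hi⟩ ⟨j, hj⟩
    simp only at h3 h4
    rw [h3, h4]
    exact ⟨(ZMod.val_lt _).le, (ZMod.val_lt _).le⟩
  address_le := h1
  value_le := h2

theorem passes_iff [NeZero q] (g : ℕ) (i : Fin m) :
    RAM.Passes (RAM.initMem (inputWords n q m d)) n q g i ↔
      IsSmall (∑ j, (d i).2 j + (g : ZMod q) * ∑ j, (d i).1 j) := by
  have hA : RAM.sumA (RAM.initMem (inputWords n q m d)) n i = ∑ j, ((d i).1 j).val := by
    rw [RAM.sumA, Finset.sum_range]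
    exact Finset.sum_congr rfl fun j _ => initMem_inputWords_fst d i j
  have hB : RAM.sumB (RAM.initMem (inputWords n q m d)) n i = ∑ j, ((d i).2 j).val := by
    rw [RAM.sumB, Finset.sum_range]
    exact Finset.sum_congr rfl fun j _ => initMem_inputWords_snd d i j
  have hv : (∑ j, ((d i).2 j).val + g * ∑ j, ((d i).1 j).val) % q =
      (∑ j, (d i).2 j + (g : ZMod q) * ∑ j, (d i).1 j).val := by
    rw [← ZMod.val_natCast]
    congr 1
    push_cast
    simp
  rw [RAM.Passes, hA, hB, hv, IsSmall]

open scoped Classical in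
theorem answerBelow_inputWords [NeZero q] :
    RAM.answerBelow (RAM.initMem (inputWords n q m d)) n q m q =
      if Accepts fun i => (∑ j, (d i).1 j, ∑ j, (d i).2 j) then 1 else 0 := by
  unfold RAM.answerBelow Accepts
  congr 1
  refine propext (exists_congr fun g => and_congr_right fun _ => ?_)
  rw [Nat.count_eq_card_filter_range, Finset.card_filter, Finset.card_filter, Finset.sum_range]
  simp only [passes_iff]

/-- The size of the numbers in memory and the number of steps, against the bound in terms of
`N = ℓ max(n, q)`. -/
theorem steps_bound {ℓ : ℕ} (hℓ : 1 ≤ ℓ) (hn : 2 ≤ n)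
    (hm : m = 32 * (ℓ + Nat.log 2 q)) :
    (m * (60 * n + 70) + q * (70 * m + 70) + 20) *
      (1 + (40 + 4 * (n * m) + 4 * n + 4 * m + (n * q + q * (n * q) + 8 * q)).size) ^ 2 ≤
      10000000 * (ℓ * max n q) * (Nat.log 2 (ℓ * max n q) + 1) ^ 3 := by
  set M := max n q with hM
  set N := ℓ * M with hN
  set L := Nat.log 2 N + 1 with hL
  have hnM : n ≤ M := le_max_left _ _
  have hqM : q ≤ M := le_max_right _ _
  have hMN : M ≤ N := Nat.le_mul_of_pos_left _ hℓ
  have hlN : ℓ ≤ N := Nat.le_mul_of_pos_right _ (by omega)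
  have hNL : N < 2 ^ L := Nat.lt_pow_succ_log_self (by norm_num) N
  have hlog : Nat.log 2 q ≤ L := (Nat.log_mono_right (hqM.trans hMN)).trans (Nat.le_succ _)
  have hlogq : Nat.log 2 q ≤ q := Nat.log_le_self 2 q
  have hL1 : 1 ≤ L := by omega
  have hN2 : 2 ≤ N := by omega
  have hmN : m ≤ 64 * N := by omega
  have hmM : m * M ≤ 64 * (N * L) := by
    have h1 : Nat.log 2 q * M ≤ L * N := Nat.mul_le_mul hlog hMN
    have h2 : N ≤ N * L := Nat.le_mul_of_pos_right _ hL1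
    calc m * M = 32 * (ℓ * M) + 32 * (Nat.log 2 q * M) := by rw [hm]; ring
      _ ≤ 32 * (N * L) + 32 * (L * N) := by omega
      _ = 64 * (N * L) := by ring
  have hsteps : m * (60 * n + 70) + q * (70 * m + 70) + 20 ≤ 20000 * (N * L) := by
    have h1 : m * n ≤ m * M := Nat.mul_le_mul_left m hnM
    have h2 : q * m ≤ m * M := by rw [mul_comm]; exact Nat.mul_le_mul_left m hqM
    have h3 : m ≤ m * M := Nat.le_mul_of_pos_right _ (by omega)
    have h4 : N ≤ N * L := Nat.le_mul_of_pos_right _ hL1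
    calc m * (60 * n + 70) + q * (70 * m + 70) + 20
        = 60 * (m * n) + 70 * m + 70 * (q * m) + 70 * q + 20 := by ring
      _ ≤ 20000 * (N * L) := by omega
  have hsize : (40 + 4 * (n * m) + 4 * n + 4 * m + (n * q + q * (n * q) + 8 * q)).size ≤
      10 + 3 * L := by
    rw [Nat.size_le]
    have h1 : n * m ≤ 64 * (N * N) := by
      calc n * m ≤ N * (64 * N) := Nat.mul_le_mul (hnM.trans hMN) hmN
        _ = _ := by ring
    have h2 : n * q ≤ N * N := Nat.mul_le_mul (hnM.trans hMN) (hqM.trans hMN)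
    have h3 : q * (n * q) ≤ N * (N * N) := Nat.mul_le_mul (hqM.trans hMN) h2
    have h4 : 2 * (N * N) ≤ N * (N * N) := Nat.mul_le_mul_right _ hN2
    have h5 : 2 * N ≤ N * N := Nat.mul_le_mul_right _ hN2
    have h6 : N * (N * N) < (2 ^ L) ^ 3 := by
      calc N * (N * N) = N ^ 3 := by ring
        _ < _ := Nat.pow_lt_pow_left hNL (by norm_num)
    calc _ ≤ 1024 * (N * (N * N)) := by omega
      _ < 1024 * (2 ^ L) ^ 3 := by omega
      _ = 2 ^ (10 + 3 * L) := by rw [pow_add 2 10 (3 * L), mul_comm 3 L, pow_mul 2 L 3]; norm_num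
  calc _ ≤ 20000 * (N * L) * (14 * L) ^ 2 :=
        Nat.mul_le_mul hsteps (Nat.pow_le_pow_left (by omega) 2)
    _ = 3920000 * (N * L ^ 3) := by ring
    _ ≤ 10000000 * (N * L ^ 3) := Nat.mul_le_mul_right _ (by norm_num)
    _ = _ := by ring

open scoped Classical in
/-- Correctness and running time of the program on an arbitrary dataset. -/
theorem exec_attack [NeZero q] {ℓ : ℕ} (hℓ : 1 ≤ ℓ) (hn : 2 ≤ n)
    (hm : m = 32 * (ℓ + Nat.log 2 q)) :
    ∃ t s, RAM.Exec RAM.attack (RAM.initMem (inputWords n q m d)) t s ∧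
      t ≤ 10000000 * (ℓ * max n q) * (Nat.log 2 (ℓ * max n q) + 1) ^ 3 ∧
      s 0 = if Accepts fun i => (∑ j, (d i).1 j, ∑ j, (d i).2 j) then 1 else 0 := by
  obtain ⟨t, s, h1, h2, h3⟩ := RAM.runs_attack (input_inputWords d (Nat.le_add_right _ _)
    (Nat.le_add_left _ _))
  exact ⟨t, s, h1, h2.trans (steps_bound hℓ hn hm), h3.trans (answerBelow_inputWords d)⟩

end Dataset

theorem theorem2 :
    ∃ (prog : RAM.Prog) (C₁ C₂ k : ℕ),
      ∀ (p r n q : ℕ) [Fact q.Prime], p.Prime → n = p ^ r → Squarefree (q - 1) →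
        ¬ (p : ℤ) ^ 2 ∣ (1 - (q : ℤ)) ^ n - (1 - (q : ℤ)) →
      -- `K = ℚ(β)` for a root `β` of `f_{n,q}`
      ∀ (K : Type*) [Field K] [NumberField K] (β : 𝓞 K),
        Polynomial.aeval β (familyPoly n q) = 0 →
        IntermediateField.adjoin ℚ {(β : K)} = ⊤ →
      ∀ (σ : ℝ) (hσ : 0 < σ) (w : ℝ), w = gaussianWidth β σ → 1 < tau n q w →
        -- the coefficient vectors are with respect to an integral basis
        (Module.finrank ℚ K = n ∧ Algebra.adjoin ℤ {β} = ⊤) ∧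
        ∀ ℓ : ℕ, 1 ≤ ℓ → ∀ m : ℕ, m = C₁ * (ℓ + Nat.log 2 q) →
          -- running time on every dataset of `m` samples
          (∀ d : Fin m → (Fin n → ZMod q) × (Fin n → ZMod q),
            RAM.DecidesIn prog (inputWords n q m d)
              (C₂ * (ℓ * max n q) * (Nat.log 2 (ℓ * max n q) + 1) ^ k)) ∧
          -- Ring-LWE samples, with an arbitrary secret, are recognised
          (∀ s : Rq K q,
            1 - (2 : ℝ≥0∞)⁻¹ ^ ℓ ≤ (iidSamples (lweSample K q σ hσ s) m).toOuterMeasure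
              {d | RAM.Answers prog (datasetWords β n m d) 1}) ∧
          -- uniformly random samples are recognised
          1 - (2 : ℝ≥0∞)⁻¹ ^ ℓ ≤ (iidSamples (uniformSample K q) m).toOuterMeasure
            {d | RAM.Answers prog (datasetWords β n m d) 0} := by
  classical
  refine ⟨RAM.attack, 32, 10000000, 3, ?_⟩
  intro p r n q _ hp hnp hsq hdvd K _ _ β hβ hK σ hσ w hw hτ
  subst hnp hw
  have hq : 2 ≤ q := (Fact.out : q.Prime).two_le
  have hn : 2 ≤ p ^ r := by
    -- for `n = 1` the number in the third hypothesis is `0`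
    rcases Nat.eq_zero_or_pos r with rfl | hr
    · exact absurd (by simp) hdvd
    · exact hp.two_le.trans (Nat.le_self_pow hr.ne' p)
  have hn0 : p ^ r ≠ 0 := by omega
  have hfr := finrank_eq hp hdvd hβ hK
  have htop := adjoin_eq_top hp hq hsq hdvd hβ hK
  have hb := gen_pow_eq (K := K) hβ
  have htr : ∀ i, 0 < i → i < p ^ r → Algebra.trace ℚ K ((β : K) ^ i) = 0 :=
    fun i h0 hi => trace_gen_pow hp hdvd hβ hK h0 hi
  refine ⟨⟨hfr, htop⟩, fun ℓ hℓ m hm => ?_⟩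
  have hexec := fun d => exec_attack (n := p ^ r) (q := q) (m := m) d hℓ hn hm
  have hrep := exists_eq_sum_smul_pow hn0 hβ htop
  obtain ⟨ev, hev⟩ := exists_evalOne (minpoly_eq_familyPoly hp hdvd hβ) htop
  have hans : ∀ d : Fin m → Rq K q × Rq K q, ∃ t s,
      RAM.Exec RAM.attack (RAM.initMem (datasetWords β (p ^ r) m d)) t s ∧
      s 0 = if Accepts fun i => (ev (d i).1, ev (d i).2) then 1 else 0 := by
    intro d
    obtain ⟨t, s, h1, -, h3⟩ := hexec fun i => (toCoeffs β (p ^ r) (d i).1, toCoeffs β (p ^ r) (d i).2)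
    simp only [evalOne_eq_sum_toCoeffs hrep hev] at h3
    exact ⟨t, s, h1, h3⟩
  refine ⟨fun d => ?_, fun s => ?_, ?_⟩
  · obtain ⟨t, s, h1, h2, h3⟩ := hexec d
    refine ⟨t, s, h1, h2, ?_⟩
    rw [h3]
    split_ifs
    · exact Or.inr rfl
    · exact Or.inl rfl
  · obtain ⟨R, hR⟩ := exists_norm_sub_thetaHom_le
      (det_embeddingMatrix_ne_zero hfr hn0 hq hb htr)
    obtain ⟨u, hu, hu1⟩ := exists_inner_eq_one hfr hn0 hq hb htr
    have herr := discreteGaussian_not_isSmall hrep hev hR hσ hu hu1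
      (sq_lt_of_one_lt_tau hfr hn hq hb htr hσ hτ)
    refine (lwe_accepts hq hσ herr s hℓ hm).trans (MeasureTheory.OuterMeasure.mono _ ?_)
    intro d hd
    obtain ⟨t, s', h1, h3⟩ := hans d
    exact ⟨t, s', h1, h3.trans (if_pos hd)⟩
  · refine (uniform_not_accepts hq ev hℓ hm).trans (MeasureTheory.OuterMeasure.mono _ ?_)
    intro d hd
    obtain ⟨t, s', h1, h3⟩ := hans d
    exact ⟨t, s', h1, h3.trans (if_neg hd)⟩
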